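/- Let $H$ be a real Hilbert space, let $A:\mathscr D(A)\subseteq H\to H$ generate an analytic semigroup $e^{tA}$, $t\ge 0$, on $H$, and equip $\mathscr D(A)$ with the graph norm $\|h\|_{\mathscr D(A)}=\|h\|_H+\|Ah\|_H$. For $\alpha\in(0,1)$ put \[ \|h\|_\alpha=\sup_{t>0}\|t^{1-\alpha}Ae^{tA}h\|_H,\qquad \mathscr D_A(\alpha,\infty)=\{h\in H:\ \|h\|_\alpha<\infty\},\qquad \|h\|_{\mathscr D_A(\alpha,\infty)}=\|h\|_H+\|h\|_\alpha . \] For a normed space $X$ and $u:[b,c]\to X$ let $|u|_\alpha=\sup_{t\ne s}\|u(t)-u(s)\|_X/|t-s|^\alpha$, let $C^\alpha([b,c];X)$ be the space of all $u$ with $|u|_\alpha<\infty$, with norm $\|u\|_{C^\alpha}=\sup\|u\|_X+|u|_\alpha$, and let $C^{1,\alpha}([b,c];X)$ be the space of all $u\in C^1([b,c];X)$ with $u'\in C^\alpha([b,c];X)$, with norm $\|u\|_{C^{1,\alpha}}=\sup\|u\|_X+\|u'\|_{C^\alpha}$. Let $T\ge 0$, $r>0$, $\alpha\in(0,1)$,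 $B_0,B_1\in\mathscr L(H)$ and $a\in L^1([-r,0];\mathbb R)$. Then there is a constant $C>0$, depending only on $A$, $r$, $T$, $\alpha$, $a$, $B_0$ and $B_1$, such that the following holds. Suppose that $f\in C^\alpha([0,T];H)$, $\phi_0\in\mathscr D(A)$, $\phi_1\in C^\alpha([-r,0];\mathscr D(A))$, $\phi_1(0)=\phi_0$, and \[ h_0:=A\phi_0+B_1\phi_1(-r)+\int_{-r}^0 a(\theta)B_0\phi_1(\theta)\,d\theta+f(0)\in\mathscr D_A(\alpha,\infty). \] Then the problem \[ \begin{cases} y'(t)=Ay(t)+B_1y(t-r)+\displaystyle\int_{-r}^0a(\theta)B_0y(t+\theta)\,d\theta+f(t),& 0\le t\le T,\\ y(0)=\phi_0,\qquad y(t)=\phi_1(t),& t\in[-r,0), \end{cases} \] has exactly one classical solution, that is, exactly one function $y:[-r,T]\to H$ with $y\in C([0,T];\mathscr D(A))\cap C^1([0,T];H)$ which satisfies the problem (with one-sided derivatives at $t=0$ and $t=T$; for $T=0$ the differential equation is an empty condition and $y'$ is taken to be $0$). Moreover $y\in C^\alpha([0,T];\mathscr D(A))\cap C^{1,\alpha}([0,T];H)$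 and \[ \max\{\|y\|_{C^\alpha([0,T];\mathscr D(A))},\|y\|_{C^{1,\alpha}([0,T];H)}\}\le C\Big(\|f\|_{C^\alpha([0,T];H)}+\|\phi_1\|_{C^\alpha([-r,0];\mathscr D(A))}+\|\phi_0\|_H+\|h_0\|_{\mathscr D_A(\alpha,\infty)}\Big). \] -/

import Mathlib

open Set Filter Topology MeasureTheory
open scoped ENNReal

noncomputable section

/-! ### The complexification of a real Hilbert space -/

/-- The complexification `H ⊕ iH` of a real Hilbert space `H`; the pair `(x, y)` stands for
`x + i y`, and the norm is `‖x + i y‖ ^ 2 = ‖x‖ ^ 2 + ‖y‖ ^ 2`. -/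
def HComplex (H : Type*) : Type _ := WithLp 2 (H × H)

namespace HComplex

variable {H : Type*}

/-- The vector `x + i y` of the complexification. -/
def mk (x y : H) : HComplex H := WithLp.toLp 2 (x, y)

/-- The real part of `x + i y`. -/
def re (w : HComplex H) : H := (WithLp.ofLp w).1

/-- The imaginary part of `x + i y`. -/
def im (w : HComplex H) : H := (WithLp.ofLp w).2

@[simp] theorem re_mk (x y : H) : (mk x y).re = x := rfl
@[simp] theorem im_mk (x y : H) : (mk x y).im = y := rfl

theorem ext' {v w : HComplex H} (h₁ : v.re = w.re) (h₂ : v.im = w.im) : v = w :=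
  WithLp.ofLp_injective 2 (Prod.ext h₁ h₂)

variable [NormedAddCommGroup H]

instance : NormedAddCommGroup (HComplex H) :=
  inferInstanceAs (NormedAddCommGroup (WithLp 2 (H × H)))

@[simp] theorem re_add (v w : HComplex H) : (v + w).re = v.re + w.re := rfl
@[simp] theorem im_add (v w : HComplex H) : (v + w).im = v.im + w.im := rfl
@[simp] theorem re_zero : (0 : HComplex H).re = 0 := rfl
@[simp] theorem im_zero : (0 : HComplex H).im = 0 := rfl

theorem norm_sq_eq (w : HComplex H) : ‖w‖ ^ 2 = ‖w.re‖ ^ 2 + ‖w.im‖ ^ 2 :=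
  WithLp.prod_norm_sq_eq_of_L2 (α := H) (β := H) w

variable [InnerProductSpace ℝ H]

/-- `(a + i b) (x + i y) = (a x - b y) + i (b x + a y)`. -/
instance : SMul ℂ (HComplex H) :=
  ⟨fun z w => mk (z.re • w.re - z.im • w.im) (z.im • w.re + z.re • w.im)⟩

@[simp] theorem re_smul (z : ℂ) (w : HComplex H) :
    (z • w).re = z.re • w.re - z.im • w.im := rfl
@[simp] theorem im_smul (z : ℂ) (w : HComplex H) :
    (z • w).im = z.im • w.re + z.re • w.im := rfl

instance : Module ℂ (HComplex H) where
  one_smul w := by apply ext' <;> simp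
  mul_smul z₁ z₂ w := by
    apply ext' <;> simp [Complex.mul_re, Complex.mul_im] <;> module
  smul_zero z := by apply ext' <;> simp
  smul_add z v w := by apply ext' <;> simp <;> abel
  add_smul z₁ z₂ w := by apply ext' <;> simp <;> module
  zero_smul w := by apply ext' <;> simp

theorem norm_smul_eq (z : ℂ) (w : HComplex H) : ‖z • w‖ = ‖z‖ * ‖w‖ := by
  have h : ‖z • w‖ ^ 2 = (‖z‖ * ‖w‖) ^ 2 := by
    rw [mul_pow, norm_sq_eq, norm_sq_eq, Complex.sq_norm, Complex.normSq_apply, re_smul,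
      im_smul, norm_sub_sq_real, norm_add_sq_real]
    simp only [norm_smul, mul_pow, Real.norm_eq_abs, sq_abs, inner_smul_left, inner_smul_right,
      conj_trivial]
    ring
  exact (pow_left_inj₀ (norm_nonneg _) (by positivity) two_ne_zero).1 h

instance : NormedSpace ℂ (HComplex H) where
  norm_smul_le z w := (norm_smul_eq z w).le

end HComplex

/-! ### Analytic semigroups and their generators -/

section Semigroup

variable {H : Type*} [NormedAddCommGroup H] [InnerProductSpace ℝ H]

/-- `S t`, `t ≥ 0`, is a `C₀`-semigroup of bounded linear operators on `H` (the values of `S` at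
negative times play no role). -/
structure IsC0Semigroup (S : ℝ → H →L[ℝ] H) : Prop where
  map_zero : S 0 = 1
  map_add : ∀ s t : ℝ, 0 ≤ s → 0 ≤ t → S (s + t) = S s * S t
  tendsto_zero : ∀ x : H, Tendsto (fun t => S t x) (𝓝[>] 0) (𝓝 x)

/-- `A` is the infinitesimal generator of `S`: `x ∈ D(A)` with `A x = v` if and only if
`(S t x - x) / t → v` as `t ↓ 0`. -/
def IsGenerator (A : H →ₗ.[ℝ] H) (S : ℝ → H →L[ℝ] H) : Prop :=
  ∀ x v : H, (x, v) ∈ A.graph ↔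
    Tendsto (fun t : ℝ => t⁻¹ • (S t x - x)) (𝓝[>] 0) (𝓝 v)

/-- The open sector `{z ≠ 0 : |arg z| < δ}` in the complex plane. -/
def openSector (δ : ℝ) : Set ℂ := {z | z ≠ 0 ∧ |z.arg| < δ}

/-- `S` is an analytic semigroup on the real Hilbert space `H`: it is a `C₀`-semigroup which,
on the complexification of `H`, extends to a holomorphic semigroup `W` of bounded complex linear
operators in some open sector around the positive half-line, with `W z w → w` as `z → 0` in the
sector. -/
structure IsAnalyticSemigroup (S : ℝ → H →L[ℝ] H) : Prop where
  isC0Semigroup : IsC0Semigroup S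
  exists_extension : ∃ δ : ℝ, 0 < δ ∧ δ ≤ Real.pi / 2 ∧
    ∃ W : ℂ → (HComplex H →L[ℂ] HComplex H),
      DifferentiableOn ℂ W (openSector δ) ∧
      (∀ z₁ ∈ openSector δ, ∀ z₂ ∈ openSector δ, W (z₁ + z₂) = W z₁ * W z₂) ∧
      (∀ w : HComplex H, Tendsto (fun z => W z w) (𝓝[openSector δ] 0) (𝓝 w)) ∧
      (∀ t : ℝ, 0 < t → ∀ x : H, W (t : ℂ) (HComplex.mk x 0) = HComplex.mk (S t x) 0)

open Classical in
/-- The value `A x` for `x ∈ D(A)`, extended by `0` off `D(A)`. -/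
def opApply (A : H →ₗ.[ℝ] H) (x : H) : H :=
  if h : x ∈ A.domain then A ⟨x, h⟩ else 0

/-- The point `(x, A x)` in the space `H × H` with the norm `‖(u, v)‖ = ‖u‖ + ‖v‖`.  For
`x ∈ D(A)` its norm is the graph norm of `x`; on `D(A)` the map is linear. -/
def graphPoint (A : H →ₗ.[ℝ] H) (x : H) : WithLp 1 (H × H) :=
  WithLp.toLp 1 (x, opApply A x)

/-- `‖h‖_α = sup_{t > 0} ‖t ^ (1 - α) A e^{tA} h‖`, as a value in `[0, ∞]`. -/
def interpSeminorm (A : H →ₗ.[ℝ] H) (S : ℝ → H →L[ℝ] H) (α : ℝ) (h : H) : ℝ≥0∞ :=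
  ⨆ t : ℝ, ⨆ _ : 0 < t, ‖(t ^ (1 - α)) • opApply A (S t h)‖ₑ

/-- The norm `‖h‖ + ‖h‖_α` of `D_A(α, ∞)`, as a value in `[0, ∞]`. -/
def interpNorm (A : H →ₗ.[ℝ] H) (S : ℝ → H →L[ℝ] H) (α : ℝ) (h : H) : ℝ≥0∞ :=
  ‖h‖ₑ + interpSeminorm A S α h

/-- The intermediate space `D_A(α, ∞)` (where `S t = e^{tA}`). -/
def interpSpace (A : H →ₗ.[ℝ] H) (S : ℝ → H →L[ℝ] H) (α : ℝ) : Set H :=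
  {h | (∀ t : ℝ, 0 < t → S t h ∈ A.domain) ∧ interpSeminorm A S α h < ∞}

end Semigroup

/-! ### Hölder spaces on a compact interval -/

section Holder

variable {X : Type*} [NormedAddCommGroup X]

/-- `sup_{t ∈ [a, b]} ‖u t‖`, as a value in `[0, ∞]`. -/
def supNormOn (a b : ℝ) (u : ℝ → X) : ℝ≥0∞ :=
  ⨆ t ∈ Icc a b, ‖u t‖ₑ

/-- `sup_{t ≠ s} ‖u t - u s‖ / |t - s| ^ α` over `t, s ∈ [a, b]`, as a value in `[0, ∞]`. -/
def holderSeminormOn (α a b : ℝ) (u : ℝ → X) : ℝ≥0∞ :=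
  ⨆ t ∈ Icc a b, ⨆ s ∈ Icc a b, ⨆ _ : t ≠ s, ‖u t - u s‖ₑ / ENNReal.ofReal (|t - s| ^ α)

/-- The norm of `C^α([a, b]; X)`, as a value in `[0, ∞]`. -/
def holderNormOn (α a b : ℝ) (u : ℝ → X) : ℝ≥0∞ :=
  supNormOn a b u + holderSeminormOn α a b u

/-- `u ∈ C^α([a, b]; X)`. -/
def MemHolderOn (α a b : ℝ) (u : ℝ → X) : Prop :=
  holderSeminormOn α a b u < ∞

variable [NormedSpace ℝ X]

/-- `u ∈ C¹([a, b]; X)`, with one-sided derivatives at the end points. -/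
def MemC1 (a b : ℝ) (u : ℝ → X) : Prop :=
  DifferentiableOn ℝ u (Icc a b) ∧ ContinuousOn (derivWithin u (Icc a b)) (Icc a b)

/-- `u ∈ C^{1,α}([a, b]; X)`. -/
def MemC1Holder (α a b : ℝ) (u : ℝ → X) : Prop :=
  MemC1 a b u ∧ MemHolderOn α a b (derivWithin u (Icc a b))

/-- The norm of `C^{1,α}([a, b]; X)`, as a value in `[0, ∞]`. -/
def c1HolderNormOn (α a b : ℝ) (u : ℝ → X) : ℝ≥0∞ :=
  supNormOn a b u + holderNormOn α a b (derivWithin u (Icc a b))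

end Holder

/-! ### Function spaces with values in the domain, and the delay equation -/

section Delay

variable {H : Type*} [NormedAddCommGroup H] [InnerProductSpace ℝ H]

/-- `u ∈ C([a, b]; D(A))`, where `D(A)` carries the graph norm. -/
def MemCDomain (A : H →ₗ.[ℝ] H) (a b : ℝ) (u : ℝ → H) : Prop :=
  (∀ t ∈ Icc a b, u t ∈ A.domain) ∧ ContinuousOn (fun t => graphPoint A (u t)) (Icc a b)

/-- `u ∈ C^α([a, b]; D(A))`, where `D(A)` carries the graph norm. -/
def MemHolderDomain (A : H →ₗ.[ℝ] H) (α a b : ℝ) (u : ℝ → H) : Prop :=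
  (∀ t ∈ Icc a b, u t ∈ A.domain) ∧ MemHolderOn α a b (fun t => graphPoint A (u t))

/-- The norm of `C^α([a, b]; D(A))`, as a value in `[0, ∞]`. -/
def holderDomainNormOn (A : H →ₗ.[ℝ] H) (α a b : ℝ) (u : ℝ → H) : ℝ≥0∞ :=
  holderNormOn α a b (fun t => graphPoint A (u t))

/-- The distributed delay term `∫_{-r}^0 a(θ) B₀ y(t + θ) dθ`. -/
def delayIntegral (r : ℝ) (a : ℝ → ℝ) (B₀ : H →L[ℝ] H) (y : ℝ → H) (t : ℝ) : H :=
  ∫ θ in (-r)..0, a θ • B₀ (y (t + θ))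

/-- `y : [-r, T] → H` is a classical solution of
`y'(t) = A y(t) + B₁ y(t - r) + ∫_{-r}^0 a(θ) B₀ y(t + θ) dθ + f(t)`, `0 ≤ t ≤ T`,
`y(0) = φ₀`, `y(t) = φ₁(t)` for `-r ≤ t < 0`. -/
structure IsClassicalSolution (A : H →ₗ.[ℝ] H) (r T : ℝ) (a : ℝ → ℝ) (B₀ B₁ : H →L[ℝ] H)
    (f : ℝ → H) (φ₀ : H) (φ₁ : ℝ → H) (y : ℝ → H) : Prop where
  memCDomain : MemCDomain A 0 T y
  memC1 : MemC1 0 T y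
  equation : ∀ t ∈ Icc 0 T, HasDerivWithinAt y
    (opApply A (y t) + B₁ (y (t - r)) + delayIntegral r a B₀ y t + f t) (Icc 0 T) t
  initial : y 0 = φ₀
  history : ∀ t ∈ Ico (-r) 0, y t = φ₁ t

end Delay

end

/-!
The delay terms involve only bounded operators on `H`, so they are a lower order perturbation of
the Cauchy problem `y' = A y + g`, and the theorem reduces to maximal Hölder regularity for that
problem.

*Smoothing.*  The holomorphic extension of the semigroup is bounded near `0` in the sector, by the
uniform boundedness principle.  Cauchy's estimate on discs of radius proportional to `t`
bounds the derivative `D t = A e^{tA}` by `M / t`, and the semigroup law bounds the increments of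
`D` by those of `-M / t`.  These facts are collected in `SmoothingSemigroup`, and nothing else about
analyticity is used.

*Mild solutions.*  The variation of constants formula is a linear Volterra equation on
`C([0, T]; H)`; the powers of its operator decay like `(k T)ⁿ / n!`, so the Neumann series gives
existence, uniqueness and a bound (`SmoothingSemigroup.exists_mild_solution`).  Classical solutions
are mild (`SmoothingSemigroup.eq_apply_add_conv`), which gives uniqueness.

*Regularity.*  A mild solution with initial value in `D(A)` is Hölder continuous with values in `H`,
because convolution with a bounded function gains every exponent below `1`
(`SmoothingSemigroup.norm_mild_sub_le`).  As `φ₁` is Hölder continuous and the two pieces match at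
`0`, the total inhomogeneity `g`, consisting of the delay terms and `f`, is Hölder continuous on
`[0, T]`, and `A φ₀ + g 0 = h₀`.  The derivative of the solution is then
`e^{tA} h₀ + ∫₀ᵗ A e^{(t-s)A} (g s - g t) ds + e^{tA} (g t - g 0)`.
The first term is Hölder continuous because `h₀ ∈ D_A(α, ∞)`, and the sum of the other two by
`SmoothingSemigroup.norm_singConv_sub_le`.  That the mild solution is classical is seen directly
from the difference quotients that define the generator
(`SmoothingSemigroup.exists_maximal_regularity`).
-/

/-! ### Smoothing estimates for analytic semigroups -/

namespace HComplex

variable {H : Type*} [NormedAddCommGroup H]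

theorem norm_mk_zero (x : H) : ‖mk x 0‖ = ‖x‖ := by
  have h := norm_sq_eq (mk x 0)
  simp only [re_mk, im_mk, norm_zero] at h
  exact (pow_left_inj₀ (norm_nonneg _) (norm_nonneg _) two_ne_zero).1 (by simpa using h)

theorem norm_re_le (w : HComplex H) : ‖w.re‖ ≤ ‖w‖ :=
  (pow_le_pow_iff_left₀ (norm_nonneg _) (norm_nonneg _) two_ne_zero).1
    (by rw [norm_sq_eq]; linarith [sq_nonneg ‖w.im‖])

instance [CompleteSpace H] : CompleteSpace (HComplex H) :=
  inferInstanceAs (CompleteSpace (WithLp 2 (H × H)))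

variable [InnerProductSpace ℝ H]

theorem re_real_smul (c : ℝ) (w : HComplex H) : (c • w).re = c • w.re := by
  rw [← Complex.coe_smul, re_smul]; simp

theorem im_real_smul (c : ℝ) (w : HComplex H) : (c • w).im = c • w.im := by
  rw [← Complex.coe_smul, im_smul]; simp

variable (H) in
/-- The inclusion `x ↦ x + i 0` of `H` in its complexification. -/
noncomputable def inclL : H →L[ℝ] HComplex H :=
  LinearMap.mkContinuous
    { toFun := fun x => mk x 0
      map_add' := fun x y => by apply ext' <;> simp
      map_smul' := fun c x => by
        apply ext' <;> simp [re_real_smul, im_real_smul] }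
    1 (fun x => by simp [norm_mk_zero])

variable (H) in
/-- The real part as a bounded real linear map. -/
noncomputable def reL : HComplex H →L[ℝ] H :=
  LinearMap.mkContinuous
    { toFun := fun w => w.re
      map_add' := fun x y => by simp
      map_smul' := re_real_smul }
    1 (fun x => by rw [one_mul]; exact norm_re_le x)

variable (H) in
/-- The compression `V ↦ (x ↦ Re (V (x + i 0)))` of complex operators to real ones. -/
noncomputable def compressL : (HComplex H →L[ℂ] HComplex H) →L[ℝ] (H →L[ℝ] H) :=
  LinearMap.mkContinuous
    { toFun := fun V => (reL H).comp ((V.restrictScalars ℝ).comp (inclL H))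
      map_add' := fun V W => by ext x; simp
      map_smul' := fun c V => by ext x; simp }
    1 (fun V => by
      refine ContinuousLinearMap.opNorm_le_bound _ (by positivity) fun x => ?_
      refine (norm_re_le _).trans ((V.le_opNorm _).trans ?_)
      rw [one_mul]
      exact (congrArg (‖V‖ * ·) (norm_mk_zero x)).le)

theorem norm_compressL_le (V : HComplex H →L[ℂ] HComplex H) : ‖compressL H V‖ ≤ ‖V‖ := by
  simpa using (compressL H).le_of_opNorm_le
    (LinearMap.mkContinuous_norm_le _ zero_le_one _) V

theorem compressL_apply (V : HComplex H →L[ℂ] HComplex H) (x : H) :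
    compressL H V x = (V (mk x 0)).re := rfl

end HComplex

/-- Some disc around `1` lies in the sector; by homogeneity, its dilates by `t > 0` are discs
around `t` of radius proportional to `t`. -/
theorem exists_closedBall_subset_openSector {δ : ℝ} (hδ : 0 < δ) :
    ∃ c : ℝ, 0 < c ∧ c < 1 ∧ ∀ t : ℝ, 0 < t →
      Metric.closedBall (t : ℂ) (c * t) ⊆ openSector δ := by
  have hcont : ContinuousAt Complex.arg 1 := Complex.continuousAt_arg (by simp)
  have hmem : openSector δ ∈ 𝓝 (1 : ℂ) := by
    have h1 : ∀ᶠ z : ℂ in 𝓝 1, |z.arg| < δ :=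
      (hcont.abs).eventually_lt_const (by simpa using hδ)
    have h2 : ∀ᶠ z : ℂ in 𝓝 1, z ≠ 0 := eventually_ne_nhds one_ne_zero
    filter_upwards [h1, h2] with z hz1 hz2 using ⟨hz2, hz1⟩
  obtain ⟨e, he, hsub⟩ := Metric.nhds_basis_closedBall.mem_iff.1 hmem
  refine ⟨min e (1 / 2), by positivity, (min_le_right _ _).trans_lt (by norm_num), ?_⟩
  intro t ht z hz
  have ht0 : (t : ℂ) ≠ 0 := by exact_mod_cast ht.ne'
  have hz' : z / t ∈ Metric.closedBall (1 : ℂ) e := by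
    rw [Metric.mem_closedBall, dist_eq_norm] at hz ⊢
    have : z / t - 1 = (z - t) / t := by field_simp
    rw [this, norm_div, Complex.norm_real, Real.norm_of_nonneg ht.le, div_le_iff₀ ht]
    exact hz.trans (mul_le_mul_of_nonneg_right (min_le_left _ _) ht.le)
  have h := hsub hz'
  have hzt : z = (t : ℂ) * (z / t) := by field_simp
  refine ⟨fun h0 => h.1 (by simp [h0]), ?_⟩
  rw [hzt, Complex.arg_real_mul _ ht]
  exact h.2

/-- A family of operators that converges strongly to the identity at `0` in a set is uniformly
bounded near `0` in that set. -/
theorem exists_norm_le_of_tendsto {E : Type*} [NormedAddCommGroup E] [NormedSpace ℂ E]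
    [CompleteSpace E] {s : Set ℂ} {W : ℂ → E →L[ℂ] E}
    (h : ∀ w, Tendsto (fun z => W z w) (𝓝[s] 0) (𝓝 w)) :
    ∃ ε : ℝ, 0 < ε ∧ ∃ M : ℝ, ∀ z ∈ s, ‖z‖ < ε → ‖W z‖ ≤ M := by
  by_contra! hcon
  have hn : ∀ n : ℕ, ∃ z ∈ s, ‖z‖ < 1 / ((n : ℝ) + 1) ∧ (n : ℝ) < ‖W z‖ := fun n =>
    hcon _ Nat.one_div_pos_of_nat n
  choose z hzs hz hW using hn
  have hz0 : Tendsto z atTop (𝓝[s] 0) := by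
    refine tendsto_nhdsWithin_iff.2 ⟨?_, Eventually.of_forall hzs⟩
    exact squeeze_zero_norm (fun n => (hz n).le) tendsto_one_div_add_atTop_nhds_zero_nat
  obtain ⟨C, hC⟩ := banach_steinhaus (g := fun n => W (z n)) fun w => by
    obtain ⟨C, hC⟩ := (((h w).comp hz0).norm).bddAbove_range
    exact ⟨C, fun n => hC ⟨n, rfl⟩⟩
  obtain ⟨n, hn⟩ := exists_nat_gt C
  linarith [hC n, hW n]

section

variable {H : Type*} [NormedAddCommGroup H] [InnerProductSpace ℝ H]

/-- The Cauchy estimate on discs of radius proportional to `t` gives `‖S' t‖ ≤ M / t` for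
small `t`. -/
theorem IsAnalyticSemigroup.exists_hasDerivAt [CompleteSpace H] {S : ℝ → H →L[ℝ] H}
    (hS : IsAnalyticSemigroup S) :
    ∃ D : ℝ → H →L[ℝ] H, (∀ t, 0 < t → HasDerivAt S (D t) t) ∧
      ∃ ε : ℝ, 0 < ε ∧ ∃ M : ℝ, ∀ t, 0 < t → t ≤ ε → ‖D t‖ ≤ M / t := by
  obtain ⟨δ, hδ, -, W, hW, -, hW0, hWS⟩ := hS.exists_extension
  obtain ⟨c, hc, hc1, hball⟩ := exists_closedBall_subset_openSector hδ
  obtain ⟨ε, hε, M, hM⟩ := exists_norm_le_of_tendsto hW0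
  refine ⟨fun t => HComplex.compressL H (deriv W t), fun t ht => ?_, ε / 4, by positivity,
    M / c, fun t ht hte => ?_⟩
  · have hnhds : openSector δ ∈ 𝓝 (t : ℂ) :=
      mem_of_superset (Metric.closedBall_mem_nhds _ (mul_pos hc ht)) (hball t ht)
    have h1 : HasDerivAt W (deriv W t) (t : ℂ) := (hW.differentiableAt hnhds).hasDerivAt
    have h2 : HasDerivAt (fun s : ℝ => W s) (deriv W t) t := by
      simpa [Function.comp_def] using h1.scomp t (Complex.ofRealCLM.hasDerivAt (x := t))
    refine ((HComplex.compressL H).hasFDerivAt.comp_hasDerivAt t h2).congr_of_eventuallyEq ?_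
    filter_upwards [lt_mem_nhds ht] with s hs
    ext x
    simp [HComplex.compressL_apply, hWS s hs x]
  · refine (HComplex.norm_compressL_le _).trans ?_
    have hb : DiffContOnCl ℂ W (Metric.ball (t : ℂ) (c * t)) :=
      (hW.mono (Metric.closure_ball_subset_closedBall.trans (hball t ht))).diffContOnCl
    have := Complex.norm_deriv_le_of_forall_mem_sphere_norm_le (C := M) (mul_pos hc ht) hb ?_
    · rwa [div_div]
    · intro z hz
      have hz' := Metric.sphere_subset_closedBall hz
      refine hM z (hball t ht hz') ?_
      have h3 : ‖z - t‖ ≤ c * t := by simpa [dist_eq_norm] using hz'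
      have h4 : ‖z‖ ≤ ‖z - t‖ + ‖(t : ℂ)‖ := by simpa using norm_add_le (z - t) (t : ℂ)
      rw [Complex.norm_real, Real.norm_of_nonneg ht.le] at h4
      nlinarith

/-- The properties of an analytic semigroup with generator `A` that maximal Hölder regularity on
`[0, τ)` rests on.  `P` is the semigroup, continued by the identity to negative times so that
`(t, x) ↦ P t x` is continuous on the whole line, and `D t = A P t` is its derivative at
`t > 0`. -/
structure SmoothingSemigroup (A : H →ₗ.[ℝ] H) (P D : ℝ → H →L[ℝ] H) (τ M : ℝ) : Prop where
  isGenerator : IsGenerator A P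
  cont : Continuous fun p : ℝ × H => P p.1 p.2
  zero_eq_one : P 0 = 1
  add_eq_mul : ∀ s t, 0 ≤ s → 0 ≤ t → P (s + t) = P s * P t
  hasDerivAt : ∀ t, 0 < t → HasDerivAt P (D t) t
  contOn_deriv : ContinuousOn D (Ioi 0)
  norm_le : ∀ t, t ≤ τ → ‖P t‖ ≤ M
  norm_deriv_le : ∀ t, 0 < t → t ≤ τ → ‖D t‖ ≤ M / t
  norm_deriv_sub_le : ∀ s t, 0 < s → s ≤ t → t ≤ τ → ‖D t - D s‖ ≤ M * ((t - s) / (s * t))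

/-- For `t > a` the semigroup law factors `S' t` through `S' a`. -/
theorem IsC0Semigroup.deriv_eq {S D : ℝ → H →L[ℝ] H} (hS : IsC0Semigroup S)
    (hD : ∀ t, 0 < t → HasDerivAt S (D t) t) {a t : ℝ} (ha : 0 < a) (hat : a ≤ t) :
    D t = S (t - a) * D a := by
  have h1 : HasDerivAt (fun s => S (t - a) * S (s - (t - a))) (S (t - a) * D a) t := by
    have h0 : HasDerivAt S (D a) (t - (t - a)) := by simpa using hD a ha
    have h2 : HasDerivAt (fun s => S (s - (t - a))) (D a) t := by
      simpa using h0.comp_sub_const t (t - a)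
    exact h2.const_mul _
  refine (hD t (ha.trans_le hat)).unique (h1.congr_of_eventuallyEq ?_)
  filter_upwards [lt_mem_nhds (show t - a < t by linarith)] with s hs
  rw [← hS.map_add _ _ (by linarith) (by linarith)]
  congr 1; ring

/-- `S' = S (· - a) S' a` beyond `a` is again differentiable; at `t = 2 a` its derivative is
`(S' (t / 2)) ^ 2`. -/
theorem IsC0Semigroup.hasDerivAt_deriv {S D : ℝ → H →L[ℝ] H} (hS : IsC0Semigroup S)
    (hD : ∀ t, 0 < t → HasDerivAt S (D t) t) {t : ℝ} (ht : 0 < t) :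
    HasDerivAt D (D (t / 2) * D (t / 2)) t := by
  have h0 : HasDerivAt S (D (t / 2)) (t - t / 2) := by
    rw [sub_half]; exact hD _ (half_pos ht)
  have h2 : HasDerivAt (fun s => S (s - t / 2)) (D (t / 2)) t := h0.comp_sub_const t (t / 2)
  refine (h2.mul_const (D (t / 2))).congr_of_eventuallyEq ?_
  filter_upwards [lt_mem_nhds (half_lt_self ht)] with s hs
  exact hS.deriv_eq hD (half_pos ht) hs.le

/-- Mean value inequality with a comparison function, where differentiability is only needed in the
open interval. -/
theorem norm_sub_le_of_hasDerivAt_le {E : Type*} [NormedAddCommGroup E] [NormedSpace ℝ E]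
    {f f' : ℝ → E} {B B' : ℝ → ℝ} {a b : ℝ} (hab : a ≤ b)
    (hf : ContinuousOn f (Icc a b)) (hf' : ∀ x ∈ Ioo a b, HasDerivAt f (f' x) x)
    (hB : ContinuousOn B (Icc a b)) (hB' : ∀ x ∈ Ioo a b, HasDerivAt B (B' x) x)
    (h : ∀ x ∈ Ioo a b, ‖f' x‖ ≤ B' x) : ‖f b - f a‖ ≤ B b - B a := by
  rcases hab.eq_or_lt with rfl | hab
  · simp
  have key : ∀ c ∈ Ioo a b, ‖f b - f c‖ ≤ B b - B c := by
    intro c hc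
    have hsub : Icc c b ⊆ Icc a b := Icc_subset_Icc_left hc.1.le
    have hsub' : ∀ x ∈ Ico c b, x ∈ Ioo a b := fun x hx => ⟨hc.1.trans_le hx.1, hx.2⟩
    exact image_norm_le_of_norm_deriv_right_le_deriv_boundary'
      (f := fun x => f x - f c) (B := fun x => B x - B c) (f' := f') (B' := B')
      ((hf.mono hsub).sub continuousOn_const)
      (fun x hx => ((hf' x (hsub' x hx)).sub_const _).hasDerivWithinAt) (by simp)
      ((hB.mono hsub).sub continuousOn_const)
      (fun x hx => ((hB' x (hsub' x hx)).sub_const _).hasDerivWithinAt)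
      (fun x hx => h x (hsub' x hx)) (right_mem_Icc.2 hc.2.le)
  have ha : a ∈ Icc a b := left_mem_Icc.2 hab.le
  have hne : (𝓝[Ioo a b] a).NeBot := by
    rw [nhdsWithin_Ioo_eq_nhdsGT hab]; infer_instance
  have hfa := ((hf a ha).mono Ioo_subset_Icc_self).tendsto
  have hBa := ((hB a ha).mono Ioo_subset_Icc_self).tendsto
  exact le_of_tendsto_of_tendsto ((tendsto_const_nhds.sub hfa).norm)
    (tendsto_const_nhds.sub hBa) (eventually_mem_nhdsWithin.mono key)

/-- An analytic semigroup is smoothing on every bounded time interval: joint continuity comes from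
strong continuity and the uniform boundedness principle, and the bound for the increments of `D`
from its derivative `t ↦ (D (t / 2)) ^ 2`. -/
theorem IsAnalyticSemigroup.exists_smoothing [CompleteSpace H] {S : ℝ → H →L[ℝ] H}
    (hS : IsAnalyticSemigroup S) {A : H →ₗ.[ℝ] H} (hA : IsGenerator A S) {τ : ℝ} :
    ∃ (D : ℝ → H →L[ℝ] H) (M : ℝ), 0 < M ∧
      SmoothingSemigroup A (fun t => S (max t 0)) D τ M := by
  have hC := hS.isC0Semigroup
  obtain ⟨D, hD, ε, hε, M₀, hM₀⟩ := hS.exists_hasDerivAt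
  have hcontx : ∀ x, ContinuousOn (fun t => S t x) (Ici 0) := by
    intro x t ht
    rcases (mem_Ici.1 ht).eq_or_lt with rfl | ht
    · have h := hC.tendsto_zero x
      rw [← continuousWithinAt_Ioi_iff_Ici]
      simpa [ContinuousWithinAt, hC.map_zero] using h
    · exact (((hD t ht).continuousAt).clm_apply continuousAt_const).continuousWithinAt
  have hbdd : ∀ τ' : ℝ, ∃ M, ∀ t, 0 ≤ t → t ≤ τ' → ‖S t‖ ≤ M := by
    intro τ'
    obtain ⟨C, hC⟩ := banach_steinhaus (g := fun t : Icc (0 : ℝ) τ' => S t) fun x => by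
      obtain ⟨C, hC⟩ := isCompact_Icc.exists_bound_of_continuousOn
        ((hcontx x).mono (Icc_subset_Ici_self : Icc 0 τ' ⊆ Ici 0))
      exact ⟨C, fun t => hC t t.2⟩
    exact ⟨C, fun t h0 h1 => hC ⟨t, h0, h1⟩⟩
  have hcont : Continuous fun p : ℝ × H => S (max p.1 0) p.2 := by
    rw [continuous_iff_continuousAt]
    rintro ⟨t, x⟩
    obtain ⟨M, hM⟩ := hbdd (max t 0 + 1)
    have hM0 : 0 ≤ M := (norm_nonneg _).trans (hM 0 le_rfl (by positivity))
    have hx : Continuous fun s : ℝ => S (max s 0) x :=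
      (hcontx x).comp_continuous (by fun_prop) (fun s => mem_Ici.2 (le_max_right _ _))
    have hlim : Tendsto (fun p : ℝ × H => M * ‖p.2 - x‖ + ‖S (max p.1 0) x - S (max t 0) x‖)
        (𝓝 (t, x)) (𝓝 0) := by
      have : Continuous fun p : ℝ × H =>
          M * ‖p.2 - x‖ + ‖S (max p.1 0) x - S (max t 0) x‖ := by
        exact (continuous_const.mul (continuous_snd.sub continuous_const).norm).add
          ((hx.comp continuous_fst).sub continuous_const).norm
      simpa using this.tendsto (t, x)
    refine tendsto_iff_norm_sub_tendsto_zero.2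
      (squeeze_zero' (Eventually.of_forall fun p => norm_nonneg _) ?_ hlim)
    have hnear : ∀ᶠ p : ℝ × H in 𝓝 (t, x), p.1 < max t 0 + 1 :=
      (continuous_fst.tendsto (t, x)).eventually_lt_const
        (show t < max t 0 + 1 by linarith [le_max_left t 0])
    filter_upwards [hnear] with p hp
    have h1 : ‖S (max p.1 0) (p.2 - x)‖ ≤ M * ‖p.2 - x‖ :=
      (S _).le_of_opNorm_le (hM _ (le_max_right _ _)
        (max_le hp.le (by positivity))) _
    have h2 : S (max p.1 0) p.2 - S (max t 0) x =
        S (max p.1 0) (p.2 - x) + (S (max p.1 0) x - S (max t 0) x) := by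
      rw [map_sub]; abel
    rw [h2]
    exact (norm_add_le _ _).trans (by gcongr)
  obtain ⟨M₁, hM₁⟩ := hbdd (max τ 0)
  have hM₁0 : 0 ≤ M₁ := (norm_nonneg _).trans (hM₁ 0 le_rfl (by positivity))
  -- beyond `ε` the bound on `S'` comes from `S' t = S (t - ε) S' ε`
  obtain ⟨M₂, hM₂0, hM₂⟩ : ∃ M₂ : ℝ, 0 ≤ M₂ ∧ ∀ t, 0 < t → t ≤ τ → ‖D t‖ ≤ M₂ / t := by
    refine ⟨|M₀| + M₁ * ‖D ε‖ * |τ|, by positivity, fun t ht htτ => ?_⟩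
    rw [le_div_iff₀ ht]
    rcases le_total t ε with h | h
    · have := hM₀ t ht h
      rw [le_div_iff₀ ht] at this
      have h3 : 0 ≤ M₁ * ‖D ε‖ * |τ| := by positivity
      linarith [le_abs_self M₀]
    · have h1 : ‖D t‖ ≤ M₁ * ‖D ε‖ := by
        rw [hC.deriv_eq hD hε h]
        refine (norm_mul_le _ _).trans ?_
        gcongr
        exact hM₁ _ (by linarith) (by linarith [le_max_left τ 0])
      have h2 : t ≤ |τ| := htτ.trans (le_abs_self τ)
      have h3 : ‖D t‖ * t ≤ M₁ * ‖D ε‖ * |τ| := by gcongr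
      linarith [abs_nonneg M₀]
  have hnon : ∀ t, 0 < t → (fun t => S (max t 0)) =ᶠ[𝓝 t] S := fun t ht => by
    filter_upwards [lt_mem_nhds ht] with s hs
    rw [max_eq_left hs.le]
  refine ⟨D, M₁ + M₂ + 4 * M₂ ^ 2 + 1, by positivity, ?_, hcont, ?_, ?_, ?_,
    fun t ht => (hC.hasDerivAt_deriv hD ht).continuousAt.continuousWithinAt, ?_, ?_, ?_⟩
  · intro x v
    rw [hA x v]
    refine tendsto_congr' ?_
    filter_upwards [self_mem_nhdsWithin] with t ht
    rw [max_eq_left (le_of_lt ht)]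
  · simp [hC.map_zero]
  · intro s t hs ht
    simp only [max_eq_left hs, max_eq_left ht, max_eq_left (add_nonneg hs ht)]
    exact hC.map_add s t hs ht
  · exact fun t ht => (hD t ht).congr_of_eventuallyEq (hnon t ht)
  · intro t ht
    have := hM₁ (max t 0) (le_max_right _ _) (max_le_max_right _ ht)
    have h2 := sq_nonneg M₂
    linarith
  · intro t ht htτ
    refine (hM₂ t ht htτ).trans ?_
    gcongr
    linarith [sq_nonneg M₂]
  · intro s t hs hst htτ
    have hpos : ∀ x ∈ Icc s t, 0 < x := fun x hx => hs.trans_le hx.1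
    have hB : ∀ x ∈ Icc s t,
        HasDerivAt (fun x => -(4 * M₂ ^ 2) * x⁻¹) (4 * M₂ ^ 2 / x ^ 2) x := fun x hx => by
      have := (hasDerivAt_inv (hpos x hx).ne').const_mul (-(4 * M₂ ^ 2))
      exact this.congr_deriv (by ring)
    have h := norm_sub_le_of_hasDerivAt_le (f := D) (f' := fun x => D (x / 2) * D (x / 2)) hst
      (fun x hx => (hC.hasDerivAt_deriv hD (hpos x hx)).continuousAt.continuousWithinAt)
      (fun x hx => hC.hasDerivAt_deriv hD (hpos x (Ioo_subset_Icc_self hx)))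
      (fun x hx => (hB x hx).continuousAt.continuousWithinAt)
      (fun x hx => hB x (Ioo_subset_Icc_self hx))
      (fun x hx => by
        have hx0 := hpos x (Ioo_subset_Icc_self hx)
        have h1 := hM₂ (x / 2) (half_pos hx0) (by linarith [hx.2])
        calc ‖D (x / 2) * D (x / 2)‖ ≤ (M₂ / (x / 2)) * (M₂ / (x / 2)) :=
              (norm_mul_le _ _).trans (by gcongr)
          _ = 4 * M₂ ^ 2 / x ^ 2 := by field_simp; ring)
    have ht0 := hs.trans_le hst
    have heq : -(4 * M₂ ^ 2) * t⁻¹ - -(4 * M₂ ^ 2) * s⁻¹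
        = 4 * M₂ ^ 2 * ((t - s) / (s * t)) := by field_simp; ring
    rw [heq] at h
    refine h.trans ?_
    have : 0 ≤ (t - s) / (s * t) := div_nonneg (by linarith) (by positivity)
    gcongr
    linarith

end

/-! ### Weakly singular integrals -/

section

theorem Real.rpow_sub_rpow_le {α s t : ℝ} (hα₀ : 0 < α) (hα₁ : α ≤ 1) (hs : 0 ≤ s)
    (hst : s ≤ t) : t ^ α - s ^ α ≤ (t - s) ^ α := by
  have := Real.rpow_add_le_add_rpow (sub_nonneg.2 hst) hs hα₀.le hα₁
  rw [sub_add_cancel] at this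
  linarith

theorem intervalIntegrable_sub_rpow {a b p : ℝ} (hp : -1 < p) :
    IntervalIntegrable (fun x => (b - x) ^ p) volume a b := by
  have := (intervalIntegral.intervalIntegrable_rpow' hp (a := b - a) (b := 0)).comp_sub_left b
  simpa using this

theorem integral_sub_rpow {a b p : ℝ} (hp : -1 < p) :
    ∫ x in a..b, (b - x) ^ p = (b - a) ^ (p + 1) / (p + 1) := by
  rw [intervalIntegral.integral_comp_sub_left (fun x => x ^ p) b, integral_rpow (Or.inl hp),
    sub_self, Real.zero_rpow (by linarith), sub_zero]

variable {E : Type*} [NormedAddCommGroup E]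

theorem continuousOn_of_norm_sub_le_rpow {u : ℝ → E} {S : Set ℝ} {c α : ℝ} (hα : 0 < α)
    (h : ∀ s ∈ S, ∀ t ∈ S, ‖u t - u s‖ ≤ c * |t - s| ^ α) : ContinuousOn u S := by
  intro s hs
  have hc : Continuous fun t : ℝ => c * |t - s| ^ α :=
    continuous_const.mul ((Real.continuous_rpow_const hα.le).comp (by fun_prop))
  have h2 := (hc.tendsto s).mono_left (nhdsWithin_le_nhds (s := S))
  refine tendsto_iff_norm_sub_tendsto_zero.2 (squeeze_zero'
    (Eventually.of_forall fun _ => norm_nonneg _)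
    (eventually_mem_nhdsWithin.mono fun t ht => h s hs t ht) ?_)
  simpa [Real.zero_rpow hα.ne'] using h2

theorem continuous_of_norm_sub_le_rpow {u : ℝ → E} {c α : ℝ} (hα : 0 < α)
    (h : ∀ s t, ‖u t - u s‖ ≤ c * |t - s| ^ α) : Continuous u :=
  continuousOn_univ.1 (continuousOn_of_norm_sub_le_rpow hα fun s _ t _ => h s t)

/-- A Hölder bound for increments over `s ≤ t` is a Hölder bound for all increments. -/
theorem norm_sub_le_of_forall_le {u : ℝ → E} {a b c α : ℝ}
    (h : ∀ s t, a ≤ s → s ≤ t → t ≤ b → ‖u t - u s‖ ≤ c * (t - s) ^ α) :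
    ∀ s ∈ Icc a b, ∀ t ∈ Icc a b, ‖u t - u s‖ ≤ c * |t - s| ^ α := by
  intro s hs t ht
  rcases le_total s t with hst | hst
  · rw [abs_of_nonneg (sub_nonneg.2 hst)]
    exact h s t hs.1 hst ht.2
  · rw [norm_sub_rev, abs_sub_comm, abs_of_nonneg (sub_nonneg.2 hst)]
    exact h t s ht.1 hst hs.2

theorem ae_mem_Ioc_of_forall_mem_Ico {a b : ℝ} {p : ℝ → Prop} (h : ∀ x ∈ Ico a b, p x) :
    ∀ᵐ x : ℝ, x ∈ Ioc a b → p x := by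
  have hb : ∀ᵐ x : ℝ, x ≠ b := compl_mem_ae_iff.2 (measure_singleton b)
  filter_upwards [hb] with x hx hmem
  exact h x ⟨hmem.1.le, lt_of_le_of_ne hmem.2 hx⟩

theorem intervalIntegrable_of_norm_le_rpow {f : ℝ → E} {a b p c : ℝ} (hab : a ≤ b)
    (hp : -1 < p) (hf : ContinuousOn f (Ico a b))
    (h : ∀ x ∈ Ico a b, ‖f x‖ ≤ c * (b - x) ^ p) : IntervalIntegrable f volume a b := by
  refine ((intervalIntegrable_sub_rpow hp).const_mul c).mono_fun' ?_ ?_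
  · rw [uIoc_of_le hab, ← restrict_Ico_eq_restrict_Ioc]
    exact hf.aestronglyMeasurable measurableSet_Ico
  · rw [uIoc_of_le hab]
    exact (ae_restrict_iff' measurableSet_Ioc).2 (ae_mem_Ioc_of_forall_mem_Ico h)

theorem norm_integral_le_of_norm_le_rpow [NormedSpace ℝ E] {f : ℝ → E} {a b p c : ℝ}
    (hab : a ≤ b) (hp : -1 < p) (h : ∀ x ∈ Ico a b, ‖f x‖ ≤ c * (b - x) ^ p) :
    ‖∫ x in a..b, f x‖ ≤ c * ((b - a) ^ (p + 1) / (p + 1)) := by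
  refine (intervalIntegral.norm_integral_le_of_norm_le hab (ae_mem_Ioc_of_forall_mem_Ico h)
    ((intervalIntegrable_sub_rpow hp).const_mul c)).trans_eq ?_
  rw [intervalIntegral.integral_const_mul, integral_sub_rpow hp]

/-- An integrand bounded by `min (x ^ (α - 1)) (h x ^ (α - 2))`, where `x` is the distance to the
end point, has an integral of order `h ^ α`; the two bounds are used on either side of
`x = h`. -/
theorem norm_integral_le_of_norm_le_min [NormedSpace ℝ E] {f : ℝ → E} {s h α c : ℝ}
    (hs : 0 ≤ s) (hh : 0 < h) (hα₀ : 0 < α) (hα₁ : α < 1) (hc : 0 ≤ c)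
    (hf : ContinuousOn f (Ico 0 s))
    (h₁ : ∀ x ∈ Ico 0 s, ‖f x‖ ≤ c * (s - x) ^ (α - 1))
    (h₂ : ∀ x ∈ Ico 0 s, ‖f x‖ ≤ c * (h * (s - x) ^ (α - 2))) :
    ‖∫ x in 0..s, f x‖ ≤ c * (1 / α + 1 / (1 - α)) * h ^ α := by
  have hhα : 0 ≤ h ^ α := Real.rpow_nonneg hh.le _
  have h1α : 0 < 1 - α := by linarith
  rcases le_total s h with hsh | hsh
  · have := norm_integral_le_of_norm_le_rpow hs (by linarith) h₁
    rw [sub_zero, sub_add_cancel] at this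
    refine this.trans ?_
    have h3 : s ^ α ≤ h ^ α := Real.rpow_le_rpow hs hsh hα₀.le
    calc c * (s ^ α / α) ≤ c * (h ^ α / α) := by gcongr
      _ ≤ c * (h ^ α / α) + c * (h ^ α / (1 - α)) := by
        have : 0 ≤ c * (h ^ α / (1 - α)) := by positivity
        linarith
      _ = _ := by ring
  · have hint := intervalIntegrable_of_norm_le_rpow hs (by linarith) hf h₁
    have h0 : 0 ≤ s - h := by linarith
    have hmem : s - h ∈ uIcc 0 s := by rw [uIcc_of_le hs]; constructor <;> linarith
    have hi1 : IntervalIntegrable f volume 0 (s - h) :=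
      hint.mono_set (uIcc_subset_uIcc_left hmem)
    have hi2 : IntervalIntegrable f volume (s - h) s :=
      hint.mono_set (uIcc_subset_uIcc_right hmem)
    rw [← intervalIntegral.integral_add_adjacent_intervals hi1 hi2]
    have b2 := norm_integral_le_of_norm_le_rpow (f := f) (a := s - h) (b := s) (by linarith)
      (by linarith) fun x hx => h₁ x ⟨h0.trans hx.1, hx.2⟩
    rw [sub_sub_cancel, sub_add_cancel] at b2
    have hci : IntervalIntegrable (fun x => c * (h * (s - x) ^ (α - 2))) volume 0 (s - h) := by
      refine ContinuousOn.intervalIntegrable ?_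
      rw [uIcc_of_le h0]
      refine continuousOn_const.mul (continuousOn_const.mul ?_)
      refine ContinuousOn.rpow_const (by fun_prop) fun x hx => Or.inl ?_
      have := hx.2
      exact ne_of_gt (by linarith)
    have b1 : ‖∫ x in 0..(s - h), f x‖ ≤ c * (h ^ α / (1 - α)) := by
      refine (intervalIntegral.norm_integral_le_of_norm_le h0
        (Eventually.of_forall fun x hx => h₂ x ⟨hx.1.le, by linarith [hx.2]⟩) hci).trans ?_
      rw [intervalIntegral.integral_const_mul, intervalIntegral.integral_const_mul,
        intervalIntegral.integral_comp_sub_left (fun x => x ^ (α - 2)) s, sub_sub_cancel, sub_zero,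
        integral_rpow (Or.inr ⟨by linarith, by
          rw [uIcc_of_le hsh]; exact fun hx => absurd hx.1 (not_le.2 hh)⟩)]
      refine mul_le_mul_of_nonneg_left ?_ hc
      have e : α - 2 + 1 = -(1 - α) := by ring
      have hpow : h * h ^ (-(1 - α)) = h ^ α := by
        nth_rewrite 1 [← Real.rpow_one h]
        rw [← Real.rpow_add hh]
        congr 1; ring
      have hspos : 0 ≤ h * s ^ (-(1 - α)) := mul_nonneg hh.le (Real.rpow_nonneg hs _)
      rw [e, div_neg, ← neg_div, neg_sub, mul_div_assoc', mul_sub, hpow]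
      gcongr
      linarith
    calc _ ≤ _ := norm_add_le _ _
      _ ≤ c * (h ^ α / (1 - α)) + c * (h ^ α / α) := add_le_add b1 b2
      _ = _ := by ring

end

/-! ### Smoothing semigroups and their generators -/

namespace SmoothingSemigroup

variable {H : Type*} [NormedAddCommGroup H] [InnerProductSpace ℝ H]
  {A : H →ₗ.[ℝ] H} {P D : ℝ → H →L[ℝ] H} {τ M : ℝ}

theorem M_nonneg (hP : SmoothingSemigroup A P D τ M) : 0 ≤ M :=
  (norm_nonneg _).trans (hP.norm_le τ le_rfl)

theorem continuous_apply (hP : SmoothingSemigroup A P D τ M) {X : Type*} [TopologicalSpace X]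
    {c : X → ℝ} {g : X → H} (hc : Continuous c) (hg : Continuous g) :
    Continuous fun s => P (c s) (g s) :=
  hP.cont.comp (hc.prodMk hg)

theorem continuousOn_deriv_apply (hP : SmoothingSemigroup A P D τ M) {c : ℝ → ℝ} {g : ℝ → H}
    {s : Set ℝ} (hc : Continuous c) (hg : Continuous g) (hpos : ∀ x ∈ s, 0 < c x) :
    ContinuousOn (fun x => D (c x) (g x)) s :=
  (hP.contOn_deriv.comp hc.continuousOn hpos).clm_apply hg.continuousOn

theorem mem_graph_deriv (hP : SmoothingSemigroup A P D τ M) {t : ℝ} (ht : 0 < t) (x : H) :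
    (P t x, D t x) ∈ A.graph := by
  rw [hP.isGenerator]
  have h0 : HasDerivAt (fun s => P s x) (D t x) t := by
    simpa using (hP.hasDerivAt t ht).clm_apply (hasDerivAt_const t x)
  have h := h0.tendsto_slope_zero_right
  refine h.congr' ?_
  filter_upwards [self_mem_nhdsWithin] with s hs
  rw [add_comm t s, hP.add_eq_mul s t (le_of_lt hs) ht.le]
  rfl

theorem mem_graph_apply (hP : SmoothingSemigroup A P D τ M) {t : ℝ} (ht : 0 ≤ t) {x v : H}
    (hx : (x, v) ∈ A.graph) : (P t x, P t v) ∈ A.graph := by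
  rw [hP.isGenerator] at hx ⊢
  refine (((P t).continuous.tendsto v).comp hx).congr' ?_
  filter_upwards [self_mem_nhdsWithin] with s hs
  have h1 : P s (P t x) = P t (P s x) := by
    change (P s * P t) x = (P t * P s) x
    rw [← hP.add_eq_mul s t (le_of_lt hs) ht, ← hP.add_eq_mul t s ht (le_of_lt hs), add_comm]
  simp [h1]

theorem graph_unique (hP : SmoothingSemigroup A P D τ M) {x v w : H}
    (hv : (x, v) ∈ A.graph) (hw : (x, w) ∈ A.graph) : v = w :=
  tendsto_nhds_unique ((hP.isGenerator x v).1 hv) ((hP.isGenerator x w).1 hw)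

theorem deriv_apply_of_mem_graph (hP : SmoothingSemigroup A P D τ M) {t : ℝ} (ht : 0 < t)
    {x v : H} (hx : (x, v) ∈ A.graph) : D t x = P t v :=
  hP.graph_unique (hP.mem_graph_deriv ht x) (hP.mem_graph_apply ht.le hx)

/-- A weakly singular bound on `t ↦ D t v` makes the orbit `t ↦ P t v` Hölder continuous. -/
theorem norm_sub_le_of_norm_deriv_le (hP : SmoothingSemigroup A P D τ M) {α s t c : ℝ} {v : H}
    (hα₀ : 0 < α) (hα₁ : α ≤ 1) (hc : 0 ≤ c) (hs : 0 ≤ s) (hst : s ≤ t)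
    (h : ∀ x ∈ Ioo s t, ‖D x v‖ ≤ c * x ^ (α - 1)) :
    ‖P t v - P s v‖ ≤ c * ((t - s) ^ α / α) := by
  have hB : ∀ x ∈ Ioo s t, HasDerivAt (fun x => c / α * x ^ α) (c * x ^ (α - 1)) x := by
    intro x hx
    have := (Real.hasDerivAt_rpow_const (p := α)
      (Or.inl (hs.trans_lt hx.1).ne')).const_mul (c / α)
    exact this.congr_deriv (by field_simp)
  have key := norm_sub_le_of_hasDerivAt_le (f := fun t => P t v) (f' := fun t => D t v) hst
    (hP.continuous_apply continuous_id continuous_const).continuousOn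
    (fun x hx => by
      simpa using (hP.hasDerivAt x (hs.trans_lt hx.1)).clm_apply (hasDerivAt_const x v))
    ((continuous_const.mul (Real.continuous_rpow_const hα₀.le)).continuousOn) hB h
  refine key.trans ?_
  have := Real.rpow_sub_rpow_le hα₀ hα₁ hs hst
  calc c / α * t ^ α - c / α * s ^ α = c * ((t ^ α - s ^ α) / α) := by ring
    _ ≤ _ := by gcongr

theorem integral_deriv_apply [CompleteSpace H] (hP : SmoothingSemigroup A P D τ M) {s t : ℝ}
    (hs : 0 ≤ s) (hst : s < t) (v : H) :
    ∫ x in 0..s, D (t - x) v = P t v - P (t - s) v := by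
  have hpos : ∀ x ∈ Icc 0 s, 0 < t - x := fun x hx => by linarith [hx.2]
  have := intervalIntegral.integral_eq_sub_of_hasDerivAt_of_le (f := fun x => -(P (t - x) v))
    (f' := fun x => D (t - x) v) hs
    (hP.continuous_apply (by fun_prop) continuous_const).neg.continuousOn
    (fun x hx => by
      have h1 := (hP.hasDerivAt _ (hpos x (Ioo_subset_Icc_self hx))).scomp x
        ((hasDerivAt_id x).const_sub t)
      simpa using (h1.clm_apply (hasDerivAt_const x v)).fun_neg)
    (by
      refine ContinuousOn.intervalIntegrable ?_
      rw [uIcc_of_le hs]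
      exact hP.continuousOn_deriv_apply (by fun_prop) continuous_const hpos)
  rw [this]
  simp only [sub_zero]
  abel

end SmoothingSemigroup

/-! ### Hölder continuity of convolutions with the semigroup -/

namespace SmoothingSemigroup

variable {H : Type*} [NormedAddCommGroup H] [InnerProductSpace ℝ H]
  {A : H →ₗ.[ℝ] H} {P D : ℝ → H →L[ℝ] H} {τ M : ℝ}

/-- The convolution `∫₀ᵗ P(t - s) g(s) ds`. -/
noncomputable def conv (P : ℝ → H →L[ℝ] H) (g : ℝ → H) (t : ℝ) : H :=
  ∫ s in 0..t, P (t - s) (g s)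

/-- The regularised singular convolution `∫₀ᵗ D(t - s) (g(s) - g(t)) ds`. -/
noncomputable def singConv (D : ℝ → H →L[ℝ] H) (g : ℝ → H) (t : ℝ) : H :=
  ∫ s in 0..t, D (t - s) (g s - g t)

theorem continuous_conv (hP : SmoothingSemigroup A P D τ M) {g : ℝ → H} (hg : Continuous g) :
    Continuous (conv P g) := by
  refine intervalIntegral.continuous_parametric_intervalIntegral_of_continuous
    (f := fun t s => P (t - s) (g s)) ?_ continuous_id
  exact hP.continuous_apply (by fun_prop) (by fun_prop)

theorem intervalIntegrable_conv (hP : SmoothingSemigroup A P D τ M) {g : ℝ → H}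
    (hg : Continuous g) (t a b : ℝ) :
    IntervalIntegrable (fun s => P (t - s) (g s)) volume a b :=
  (hP.continuous_apply (by fun_prop) hg).intervalIntegrable _ _

theorem norm_conv_le (hP : SmoothingSemigroup A P D τ M) {g : ℝ → H} {B t : ℝ}
    (ht : 0 ≤ t) (htτ : t ≤ τ) (hg : ∀ s ∈ Icc 0 t, ‖g s‖ ≤ B) : ‖conv P g t‖ ≤ M * B * t := by
  have := intervalIntegral.norm_integral_le_of_norm_le_const (a := 0) (b := t)
    (f := fun s => P (t - s) (g s)) (C := M * B) fun s hs => by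
      rw [uIoc_of_le ht] at hs
      exact (P _).le_of_opNorm_le_of_le (hP.norm_le _ (by linarith [hs.1])) (hg s ⟨hs.1.le, hs.2⟩)
  rwa [sub_zero, abs_of_nonneg ht] at this

/-- Convolution with a bounded function is Hölder continuous of every exponent below `1`. -/
theorem norm_conv_sub_le (hP : SmoothingSemigroup A P D τ M) {g : ℝ → H} {α B s t : ℝ}
    (hα₀ : 0 < α) (hα₁ : α < 1) (hgc : Continuous g) (hg : ∀ s, ‖g s‖ ≤ B)
    (hs : 0 ≤ s) (hst : s ≤ t) (htτ : t ≤ τ) :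
    ‖conv P g t - conv P g s‖ ≤
      M * B * τ ^ (1 - α) * (1 / (α * (1 - α)) + 1) * (t - s) ^ α := by
  have hM := hP.M_nonneg
  have hB : 0 ≤ B := (norm_nonneg _).trans (hg 0)
  have h1α : 0 < 1 - α := by linarith
  have hτ : 0 ≤ τ := hs.trans (hst.trans htτ)
  have hh : 0 ≤ t - s := by linarith
  have hsplit : conv P g t - conv P g s =
      (∫ x in 0..s, (P (t - x) (g x) - P (s - x) (g x))) + ∫ x in s..t, P (t - x) (g x) := by
    rw [intervalIntegral.integral_sub (hP.intervalIntegrable_conv hgc _ _ _)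
      (hP.intervalIntegrable_conv hgc _ _ _), conv, conv,
      ← intervalIntegral.integral_add_adjacent_intervals
        (hP.intervalIntegrable_conv hgc t 0 s) (hP.intervalIntegrable_conv hgc t s t)]
    abel
  have b1 : ‖∫ x in 0..s, (P (t - x) (g x) - P (s - x) (g x))‖ ≤
      M * B * ((t - s) ^ α / α) * ((s - 0) ^ (-α + 1) / (-α + 1)) := by
    refine norm_integral_le_of_norm_le_rpow hs (by linarith) fun x hx => ?_
    have hsx : 0 < s - x := by linarith [hx.2]
    have key := hP.norm_sub_le_of_norm_deriv_le (v := g x) (s := s - x) (t := t - x)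
      (c := M * B * (s - x) ^ (-α)) hα₀ hα₁.le (by positivity) hsx.le (by linarith)
      (fun y hy => by
        have hy0 : 0 < y := hsx.trans hy.1
        have h1 : ‖D y (g x)‖ ≤ M / y * B :=
          (D y).le_of_opNorm_le_of_le (hP.norm_deriv_le y hy0 (by linarith [hy.2, hx.1])) (hg x)
        -- `y⁻¹ = y ^ (-α) * y ^ (α - 1)`, and the first factor is largest at `y = s - x`
        have h2 : y⁻¹ = y ^ (-α) * y ^ (α - 1) := by
          rw [← Real.rpow_add hy0, ← Real.rpow_neg_one]; congr 1; ring
        have h3 : y ^ (-α) ≤ (s - x) ^ (-α) :=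
          Real.rpow_le_rpow_of_nonpos hsx hy.1.le (by linarith)
        calc ‖D y (g x)‖ ≤ M * B * (y ^ (-α) * y ^ (α - 1)) := by
              rw [← h2]; exact h1.trans_eq (by ring)
          _ ≤ M * B * ((s - x) ^ (-α) * y ^ (α - 1)) := by gcongr
          _ = _ := by ring)
    rw [sub_sub_sub_cancel_right] at key
    exact key.trans_eq (by ring)
  have b2 : ‖∫ x in s..t, P (t - x) (g x)‖ ≤ M * B * (t - s) := by
    have := intervalIntegral.norm_integral_le_of_norm_le_const (a := s) (b := t)
      (f := fun x => P (t - x) (g x)) (C := M * B) fun x hx => by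
        rw [uIoc_of_le hst] at hx
        exact (P _).le_of_opNorm_le_of_le (hP.norm_le _ (by linarith [hx.1])) (hg x)
    rwa [abs_of_nonneg hh] at this
  have e1 : (s - 0) ^ (-α + 1) ≤ τ ^ (1 - α) := by
    rw [sub_zero, neg_add_eq_sub]
    exact Real.rpow_le_rpow hs (hst.trans htτ) h1α.le
  have e2 : t - s ≤ τ ^ (1 - α) * (t - s) ^ α := by
    rcases hh.eq_or_lt with h0 | h0
    · rw [← h0]; positivity
    · calc t - s = (t - s) ^ (1 - α) * (t - s) ^ α := by
            rw [← Real.rpow_add h0, sub_add_cancel, Real.rpow_one]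
        _ ≤ _ := by gcongr; linarith
  rw [hsplit]
  refine (norm_add_le _ _).trans ((add_le_add b1 b2).trans ?_)
  calc _ ≤ M * B * ((t - s) ^ α / α) * (τ ^ (1 - α) / (-α + 1)) +
        M * B * (τ ^ (1 - α) * (t - s) ^ α) := by
        gcongr
        linarith
    _ = _ := by
      have : -α + 1 ≠ 0 := by linarith
      rw [neg_add_eq_sub] at *
      field_simp

theorem singConv_integrand_bound (hP : SmoothingSemigroup A P D τ M) {g : ℝ → H} {α G t : ℝ}
    (htτ : t ≤ τ) (hg : ∀ s t, ‖g t - g s‖ ≤ G * |t - s| ^ α) {x : ℝ} (hx : x ∈ Ico 0 t) :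
    ‖D (t - x) (g x - g t)‖ ≤ M * G * (t - x) ^ (α - 1) := by
  have htx : 0 < t - x := by linarith [hx.2]
  have h1 := hg t x
  rw [abs_sub_comm, abs_of_pos htx] at h1
  refine ((D _).le_of_opNorm_le_of_le
    (hP.norm_deriv_le _ htx (by linarith [hx.1])) h1).trans_eq ?_
  rw [Real.rpow_sub_one htx.ne']
  ring

theorem intervalIntegrable_singConv (hP : SmoothingSemigroup A P D τ M) {g : ℝ → H}
    {α G t : ℝ} (hα₀ : 0 < α) (hgc : Continuous g) (ht : 0 ≤ t) (htτ : t ≤ τ)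
    (hg : ∀ s t, ‖g t - g s‖ ≤ G * |t - s| ^ α) :
    IntervalIntegrable (fun x => D (t - x) (g x - g t)) volume 0 t :=
  intervalIntegrable_of_norm_le_rpow ht (by linarith)
    (hP.continuousOn_deriv_apply (by fun_prop) (by fun_prop) fun x hx => by linarith [hx.2])
    fun _ hx => hP.singConv_integrand_bound htτ hg hx

/-- The key regularity estimate: `t ↦ ∫₀ᵗ D(t - x)(g(x) - g(t)) dx + P(t)(g(t) - g(0))` inherits
the Hölder exponent of `g`.  The increment splits into an integral of
`D(t - x) - D(s - x)`, an integral over `[s, t]`, and terms without an integral. -/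
theorem norm_singConv_sub_le [CompleteSpace H] (hP : SmoothingSemigroup A P D τ M) {g : ℝ → H}
    {α G s t : ℝ} (hα₀ : 0 < α) (hα₁ : α < 1) (hgc : Continuous g) (hG : 0 ≤ G)
    (hg : ∀ s t, ‖g t - g s‖ ≤ G * |t - s| ^ α) (hs : 0 ≤ s) (hst : s ≤ t) (htτ : t ≤ τ) :
    ‖(singConv D g t + P t (g t - g 0)) - (singConv D g s + P s (g s - g 0))‖ ≤
      M * G * (3 / α + 1 / (1 - α) + 3) * (t - s) ^ α := by
  have hM := hP.M_nonneg
  rcases hst.eq_or_lt with rfl | hlt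
  · simp [Real.zero_rpow hα₀.ne']
  have hh : 0 < t - s := by linarith
  have ht : 0 ≤ t := hs.trans hst
  have hgst : ‖g s - g t‖ ≤ G * (t - s) ^ α := by
    have := hg t s
    rwa [abs_sub_comm, abs_of_pos hh] at this
  have hpos : ∀ x ∈ Icc 0 s, 0 < t - x := fun x hx => by linarith [hx.2]
  have hcont : ∀ v : H, ContinuousOn (fun x => D (t - x) (g x - v)) (Icc 0 s) := fun v =>
    hP.continuousOn_deriv_apply (by fun_prop) (by fun_prop) hpos
  have hmem : s ∈ uIcc 0 t := by rw [uIcc_of_le ht]; exact ⟨hs, hst⟩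
  have hI := hP.intervalIntegrable_singConv hα₀ hgc ht htτ hg
  have hIs := hP.intervalIntegrable_singConv hα₀ hgc hs (hst.trans htτ) hg
  have hI1 := hI.mono_set (uIcc_subset_uIcc_left hmem)
  have hI2 := hI.mono_set (uIcc_subset_uIcc_right hmem)
  have hIv : IntervalIntegrable (fun x => D (t - x) (g x - g s)) volume 0 s := by
    refine ContinuousOn.intervalIntegrable ?_
    rw [uIcc_of_le hs]; exact hcont _
  have hIc : IntervalIntegrable (fun x => D (t - x) (g s - g t)) volume 0 s := by
    refine ContinuousOn.intervalIntegrable ?_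
    rw [uIcc_of_le hs]
    exact hP.continuousOn_deriv_apply (by fun_prop) continuous_const hpos
  have hsplit : (singConv D g t + P t (g t - g 0)) - (singConv D g s + P s (g s - g 0)) =
      (∫ x in 0..s, (D (t - x) (g x - g s) - D (s - x) (g x - g s))) +
      (∫ x in s..t, D (t - x) (g x - g t)) + (P t (g s - g t) - P (t - s) (g s - g t)) +
      P t (g t - g s) + (P t (g s - g 0) - P s (g s - g 0)) := by
    rw [intervalIntegral.integral_sub hIv hIs, ← hP.integral_deriv_apply hs hlt (g s - g t),
      singConv, singConv, ← intervalIntegral.integral_add_adjacent_intervals hI1 hI2]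
    have e : ∫ x in 0..s, D (t - x) (g x - g t) =
        (∫ x in 0..s, D (t - x) (g x - g s)) + ∫ x in 0..s, D (t - x) (g s - g t) := by
      rw [← intervalIntegral.integral_add hIv hIc]
      congr 1 with x
      rw [← map_add, sub_add_sub_cancel]
    have e2 : P t (g t - g 0) = P t (g t - g s) + P t (g s - g 0) := by
      rw [← map_add, sub_add_sub_cancel]
    rw [e, e2]
    abel
  have hD : ∀ x ∈ Ico 0 s, ‖D (t - x) (g x - g s) - D (s - x) (g x - g s)‖ ≤
      M * ((t - s) / ((s - x) * (t - x))) * (G * (s - x) ^ α) := by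
    intro x hx
    have hsx : 0 < s - x := by linarith [hx.2]
    have h1 := hg s x
    rw [abs_sub_comm, abs_of_pos hsx] at h1
    have h2 := hP.norm_deriv_sub_le (s - x) (t - x) hsx (by linarith) (by linarith [hx.1])
    rw [sub_sub_sub_cancel_right] at h2
    exact ((D (t - x) - D (s - x)).le_of_opNorm_le_of_le h2 h1)
  have b1 : ‖∫ x in 0..s, (D (t - x) (g x - g s) - D (s - x) (g x - g s))‖ ≤
      M * G * (1 / α + 1 / (1 - α)) * (t - s) ^ α := by
    refine norm_integral_le_of_norm_le_min hs hh hα₀ hα₁ (by positivity) ?_ ?_ ?_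
    · exact ((hcont _).mono Ico_subset_Icc_self).sub
        (hP.continuousOn_deriv_apply (by fun_prop) (by fun_prop) fun x hx => by linarith [hx.2])
    · intro x hx
      have hsx : 0 < s - x := by linarith [hx.2]
      have htx : 0 < t - x := by linarith
      refine (hD x hx).trans ?_
      have h3 : (t - s) / ((s - x) * (t - x)) ≤ (s - x)⁻¹ := by
        rw [div_le_iff₀ (by positivity)]
        field_simp
        linarith
      calc _ ≤ M * (s - x)⁻¹ * (G * (s - x) ^ α) := by gcongr
        _ = _ := by rw [Real.rpow_sub_one hsx.ne']; ring
    · intro x hx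
      have hsx : 0 < s - x := by linarith [hx.2]
      have htx : 0 < t - x := by linarith
      refine (hD x hx).trans ?_
      calc _ ≤ M * ((t - s) / ((s - x) * (s - x))) * (G * (s - x) ^ α) := by gcongr
        _ = _ := by
          rw [Real.rpow_sub hsx, Real.rpow_two]; ring
  have b2 : ‖∫ x in s..t, D (t - x) (g x - g t)‖ ≤ M * G * ((t - s) ^ α / α) := by
    have := norm_integral_le_of_norm_le_rpow (f := fun x => D (t - x) (g x - g t)) hst
      (by linarith) fun x hx => hP.singConv_integrand_bound htτ hg ⟨hs.trans hx.1, hx.2⟩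
    rwa [sub_add_cancel] at this
  have b3 : ‖P t (g s - g t) - P (t - s) (g s - g t)‖ ≤ 2 * (M * (G * (t - s) ^ α)) := by
    refine (norm_sub_le _ _).trans ?_
    have h1 := (P t).le_of_opNorm_le_of_le (hP.norm_le t htτ) hgst
    have h2 := (P (t - s)).le_of_opNorm_le_of_le (hP.norm_le (t - s) (by linarith)) hgst
    linarith
  have b4 : ‖P t (g t - g s)‖ ≤ M * (G * (t - s) ^ α) :=
    (P t).le_of_opNorm_le_of_le (hP.norm_le t htτ) (by rwa [norm_sub_rev])
  have b5 : ‖P t (g s - g 0) - P s (g s - g 0)‖ ≤ M * G * ((t - s) ^ α / α) := by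
    refine hP.norm_sub_le_of_norm_deriv_le hα₀ hα₁.le (by positivity) hs hst fun x hx => ?_
    have hx0 : 0 < x := hs.trans_lt hx.1
    have h1 := hg 0 s
    rw [sub_zero, abs_of_nonneg hs] at h1
    have h2 : s ^ α ≤ x ^ α := Real.rpow_le_rpow hs hx.1.le hα₀.le
    refine ((D x).le_of_opNorm_le_of_le (hP.norm_deriv_le x hx0 (by linarith [hx.2])) h1).trans ?_
    calc M / x * (G * s ^ α) ≤ M / x * (G * x ^ α) := by gcongr
      _ = _ := by rw [Real.rpow_sub_one hx0.ne']; ring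
  rw [hsplit]
  refine (norm_add_le _ _).trans ((add_le_add ((norm_add_le _ _).trans (add_le_add
    ((norm_add_le _ _).trans (add_le_add ((norm_add_le _ _).trans (add_le_add b1 b2)) b3))
    b4)) b5).trans_eq ?_)
  ring

end SmoothingSemigroup

/-! ### The inhomogeneous Cauchy problem -/

namespace SmoothingSemigroup

variable {H : Type*} [NormedAddCommGroup H] [InnerProductSpace ℝ H]
  {A : H →ₗ.[ℝ] H} {P D : ℝ → H →L[ℝ] H} {τ M : ℝ}

theorem apply_apply (hP : SmoothingSemigroup A P D τ M) {s t : ℝ} (hs : 0 ≤ s) (ht : 0 ≤ t)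
    (x : H) : P s (P t x) = P (s + t) x := by
  rw [hP.add_eq_mul s t hs ht]; rfl

theorem mem_graph_integral [CompleteSpace H] (hP : SmoothingSemigroup A P D τ M) {t : ℝ}
    (ht : 0 ≤ t) (x : H) : (∫ s in 0..t, P (t - s) x, P t x - x) ∈ A.graph := by
  rw [hP.isGenerator]
  have hc : Continuous fun s => P s x := hP.continuous_apply continuous_id continuous_const
  have hF : ∀ a, HasDerivAt (fun b => ∫ s in 0..b, P s x) (P a x) a := fun a =>
    intervalIntegral.integral_hasDerivAt_right (hc.intervalIntegrable _ _)
      (hc.stronglyMeasurableAtFilter _ _) hc.continuousAt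
  have h1 := (hF t).tendsto_slope_zero_right
  have h2 := (hF 0).tendsto_slope_zero_right
  rw [hP.zero_eq_one] at h2
  simp only [zero_add, intervalIntegral.integral_same, sub_zero,
    one_apply_eq_self] at h2
  refine (h1.sub h2).congr' ?_
  filter_upwards [self_mem_nhdsWithin] with h hh
  have hh0 : 0 ≤ h := le_of_lt hh
  rw [← smul_sub]
  congr 1
  have e1 : ∫ s in 0..t, P (t - s) x = ∫ s in 0..t, P s x := by
    rw [intervalIntegral.integral_comp_sub_left (fun s => P s x) t, sub_self, sub_zero]
  have e2 : P h (∫ s in 0..t, P s x) = ∫ s in h..t + h, P s x := by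
    rw [← (P h).intervalIntegral_comp_comm (hc.intervalIntegrable _ _)]
    have : ∫ s in 0..t, P h (P s x) = ∫ s in 0..t, P (s + h) x := by
      refine intervalIntegral.integral_congr fun s hs => ?_
      rw [uIcc_of_le ht] at hs
      simp only [hP.apply_apply hh0 hs.1, add_comm h s]
    rw [this, intervalIntegral.integral_comp_add_right (fun s => P s x) h, zero_add]
  rw [e1, e2]
  have i := fun a b => hc.intervalIntegrable (μ := volume) a b
  rw [← intervalIntegral.integral_add_adjacent_intervals (i 0 h) (i h (t + h))]
  abel

/-- For Hölder continuous `g` the convolution takes values in the domain of the generator.  The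
difference quotients converge under the integral sign, dominated by `(t - s) ^ (α - 1)`, once the
constant `g t` has been subtracted from `g`. -/
theorem mem_graph_conv [CompleteSpace H] (hP : SmoothingSemigroup A P D τ M) {g : ℝ → H}
    {α G t : ℝ} (hα₀ : 0 < α) (hgc : Continuous g)
    (hg : ∀ s t, ‖g t - g s‖ ≤ G * |t - s| ^ α) (ht : 0 ≤ t) (htτ : t < τ) :
    (conv P g t, singConv D g t + P t (g t) - g t) ∈ A.graph := by
  have hM := hP.M_nonneg
  have hreg : (∫ s in 0..t, P (t - s) (g s - g t), singConv D g t) ∈ A.graph := by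
    rw [hP.isGenerator]
    have hi : IntervalIntegrable (fun s => P (t - s) (g s - g t)) volume 0 t :=
      hP.intervalIntegrable_conv (by fun_prop) _ _ _
    have hlim : Tendsto (fun h : ℝ => ∫ s in 0..t, h⁻¹ • (P h (P (t - s) (g s - g t))
        - P (t - s) (g s - g t))) (𝓝[>] 0) (𝓝 (singConv D g t)) := by
      refine intervalIntegral.tendsto_integral_filter_of_dominated_convergence
        (fun s => M * G * (t - s) ^ (α - 1)) ?_ ?_
        ((intervalIntegrable_sub_rpow (by linarith)).const_mul _) ?_
      · refine Eventually.of_forall fun h => Continuous.aestronglyMeasurable ?_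
        have hc : Continuous fun s => P (t - s) (g s - g t) :=
          hP.continuous_apply (by fun_prop) (by fun_prop)
        exact (((P h).continuous.comp hc).sub hc).const_smul _
      · filter_upwards [Ioo_mem_nhdsGT (sub_pos.2 htτ)] with h hh
        rw [uIoc_of_le ht]
        refine ae_mem_Ioc_of_forall_mem_Ico fun s hs => ?_
        have hts : 0 < t - s := by linarith [hs.2]
        set v := g s - g t with hv
        have hvn : ‖v‖ ≤ G * (t - s) ^ α := by
          have := hg t s
          rwa [abs_sub_comm, abs_of_pos hts] at this
        -- the Lipschitz case of the orbit estimate, with `‖D y‖ ≤ M / (t - s)` for `t - s ≤ y`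
        have h1 : ‖P (h + (t - s)) v - P (t - s) v‖ ≤
            M / (t - s) * ‖v‖ * ((h + (t - s) - (t - s)) ^ (1 : ℝ) / 1) := by
          refine hP.norm_sub_le_of_norm_deriv_le one_pos le_rfl (by positivity) hts.le
            (by linarith [hh.1]) fun y hy => ?_
          rw [sub_self, Real.rpow_zero, mul_one]
          refine (D y).le_of_opNorm_le ?_ v
          refine (hP.norm_deriv_le y (hts.trans hy.1) (by linarith [hy.2, hh.2, hs.1])).trans ?_
          have := hy.1.le
          gcongr
        rw [add_sub_cancel_right, Real.rpow_one, div_one] at h1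
        rw [hP.apply_apply hh.1.le hts.le, norm_smul, norm_inv, Real.norm_of_nonneg hh.1.le,
          inv_mul_le_iff₀ hh.1]
        refine h1.trans ?_
        have h0 := hh.1.le
        calc M / (t - s) * ‖v‖ * h ≤ M / (t - s) * (G * (t - s) ^ α) * h := by gcongr
          _ = h * (M * G * (t - s) ^ (α - 1)) := by rw [Real.rpow_sub_one hts.ne']; ring
      · rw [uIoc_of_le ht]
        refine ae_mem_Ioc_of_forall_mem_Ico fun s hs => ?_
        have hts : 0 < t - s := by linarith [hs.2]
        exact (hP.isGenerator _ _).1 (hP.mem_graph_deriv hts _)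
    refine hlim.congr fun h => ?_
    rw [intervalIntegral.integral_smul, intervalIntegral.integral_sub _ hi,
      (P h).intervalIntegral_comp_comm hi]
    exact (((P h).continuous.comp
      (hP.continuous_apply (by fun_prop) (by fun_prop))).intervalIntegrable _ _)
  have hadd := A.graph.add_mem hreg (hP.mem_graph_integral ht (g t))
  convert hadd using 1
  rw [Prod.mk_add_mk, ← intervalIntegral.integral_add
    (hP.intervalIntegrable_conv (by fun_prop) _ _ _)
    (hP.intervalIntegrable_conv continuous_const _ _ _)]
  refine Prod.ext ?_ (by simp only; abel)
  simp only [conv]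
  congr 1 with s
  rw [← _root_.map_add, sub_add_cancel]

theorem conv_add [CompleteSpace H] (hP : SmoothingSemigroup A P D τ M) {g : ℝ → H}
    (hgc : Continuous g) {t h : ℝ} (ht : 0 ≤ t) (hh : 0 ≤ h) :
    conv P g (t + h) = P h (conv P g t) + ∫ s in t..t + h, P (t + h - s) (g s) := by
  rw [conv, conv, ← (P h).intervalIntegral_comp_comm (hP.intervalIntegrable_conv hgc _ _ _),
    ← intervalIntegral.integral_add_adjacent_intervals
      (hP.intervalIntegrable_conv hgc _ 0 t) (hP.intervalIntegrable_conv hgc _ t _)]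
  congr 1
  refine intervalIntegral.integral_congr fun s hs => ?_
  rw [uIcc_of_le ht] at hs
  rw [hP.apply_apply hh (by linarith [hs.2])]
  congr 2; ring

theorem tendsto_average_conv [CompleteSpace H] (hP : SmoothingSemigroup A P D τ M) {g : ℝ → H}
    (hgc : Continuous g) (t : ℝ) :
    Tendsto (fun h : ℝ => h⁻¹ • ∫ s in t..t + h, P (t + h - s) (g s)) (𝓝[>] 0) (𝓝 (g t)) := by
  have hc : Continuous fun p : ℝ × ℝ => P p.1 (g p.2) :=
    hP.continuous_apply continuous_fst (hgc.comp continuous_snd)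
  rw [Metric.tendsto_nhds]
  intro ε hε
  obtain ⟨δ, hδ, hball⟩ := Metric.continuousAt_iff.1 (hc.continuousAt (x := (0, t))) (ε / 2)
    (half_pos hε)
  filter_upwards [Ioo_mem_nhdsGT hδ] with h hh
  have h0 := hh.1
  have hi : IntervalIntegrable (fun s => P (t + h - s) (g s)) volume t (t + h) :=
    (hP.continuous_apply (by fun_prop) hgc).intervalIntegrable _ _
  have hconst : g t = h⁻¹ • ∫ _ in t..t + h, g t := by
    rw [intervalIntegral.integral_const, add_sub_cancel_left, smul_smul,
      inv_mul_cancel₀ h0.ne', one_smul]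
  rw [dist_eq_norm]
  nth_rewrite 1 [hconst]
  rw [← smul_sub, ← intervalIntegral.integral_sub hi intervalIntegrable_const, norm_smul,
    norm_inv, Real.norm_of_nonneg h0.le]
  have hb := intervalIntegral.norm_integral_le_of_norm_le_const (a := t) (b := t + h)
    (f := fun s => P (t + h - s) (g s) - g t) (C := ε / 2) fun s hs => by
      rw [uIoc_of_le (by linarith)] at hs
      have := @hball (t + h - s, s) (by
        rw [Prod.dist_eq, max_lt_iff, Real.dist_eq, Real.dist_eq, abs_lt, abs_lt]
        refine ⟨⟨?_, ?_⟩, ?_, ?_⟩ <;> simp only <;> linarith [hs.1, hs.2, hh.2])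
      rw [dist_eq_norm] at this
      simpa [hP.zero_eq_one] using this.le
  rw [add_sub_cancel_left, abs_of_pos h0] at hb
  rw [inv_mul_lt_iff₀ h0]
  nlinarith

/-- A continuous function on `[0, T]` with a continuous right derivative is differentiable. -/
theorem _root_.hasDerivWithinAt_of_right_deriv {E : Type*} [NormedAddCommGroup E]
    [NormedSpace ℝ E] [CompleteSpace E] {u q : ℝ → E} {T : ℝ} (hT : 0 ≤ T) (hu : Continuous u)
    (hq : ContinuousOn q (Icc 0 T))
    (h : ∀ t ∈ Ico 0 T, HasDerivWithinAt u (q t) (Ici t) t) :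
    ∀ t ∈ Icc 0 T, HasDerivWithinAt u (q t) (Icc 0 T) t := by
  have hq' : Continuous (IccExtend hT ((Icc 0 T).domRestrict q)) :=
    (continuousOn_iff_continuous_domRestrict.1 hq).Icc_extend'
  set Q := IccExtend hT ((Icc 0 T).domRestrict q) with hQ
  have hQq : ∀ t ∈ Icc 0 T, Q t = q t := fun t ht => IccExtend_of_mem hT _ ht
  have hF : ∀ a, HasDerivAt (fun b => ∫ s in 0..b, Q s) (Q a) a := fun a =>
    intervalIntegral.integral_hasDerivAt_right (hq'.intervalIntegrable _ _)
      (hq'.stronglyMeasurableAtFilter _ _) hq'.continuousAt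
  have hFc : Continuous fun b => ∫ s in 0..b, Q s :=
    continuous_iff_continuousAt.2 fun a => (hF a).continuousAt
  have hconst := constant_of_has_deriv_right_zero (f := fun b => u b - ∫ s in 0..b, Q s)
    (a := 0) (b := T) (hu.sub hFc).continuousOn fun t ht => by
      have := (h t ht).sub (hF t).hasDerivWithinAt
      rwa [hQq t (Ico_subset_Icc_self ht), sub_self] at this
  intro t ht
  have h1 : HasDerivWithinAt (fun b => u 0 + ∫ s in 0..b, Q s) (q t) (Icc 0 T) t := by
    rw [← hQq t ht]
    exact ((hF t).const_add _).hasDerivWithinAt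
  have h2 : ∀ b ∈ Icc 0 T, u b = u 0 + ∫ s in 0..b, Q s := fun b hb => by
    have := hconst b hb
    rw [intervalIntegral.integral_same, sub_zero, sub_eq_iff_eq_add] at this
    exact this
  exact h1.congr h2 (h2 t ht)

/-- Maximal Hölder regularity for `u' = A u + g`, `u 0 = x`, where the hypothesis on
`A x + g 0 = v + g 0` says that it lies in the intermediate space of exponent `α`. -/
theorem exists_maximal_regularity [CompleteSpace H] (hP : SmoothingSemigroup A P D τ M)
    {α T : ℝ} (hα₀ : 0 < α) (hα₁ : α < 1) (hT : 0 ≤ T) (hTτ : T < τ) :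
    ∃ K : ℝ, 0 ≤ K ∧ ∀ (g : ℝ → H) (x v : H) (G : ℝ), Continuous g → (x, v) ∈ A.graph →
      (∀ s t, ‖g t - g s‖ ≤ G * |t - s| ^ α) →
      (∀ t, 0 < t → ‖D t (v + g 0)‖ ≤ G * t ^ (α - 1)) →
      ∃ q : ℝ → H, q 0 = v + g 0 ∧
        (∀ t ∈ Icc 0 T, (P t x + conv P g t, q t - g t) ∈ A.graph) ∧
        (∀ t ∈ Icc 0 T, HasDerivWithinAt (fun t => P t x + conv P g t) (q t) (Icc 0 T) t) ∧
        ∀ s ∈ Icc 0 T, ∀ t ∈ Icc 0 T, ‖q t - q s‖ ≤ K * G * |t - s| ^ α := by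
  have hM := hP.M_nonneg
  have h1α : 0 < 1 - α := by linarith
  refine ⟨1 / α + M * (3 / α + 1 / (1 - α) + 3), by positivity, ?_⟩
  intro g x v G hgc hx hg hv
  have hG : 0 ≤ G := by simpa using (norm_nonneg _).trans (hg 0 1)
  set q : ℝ → H := fun t => P t (v + g 0) + (singConv D g t + P t (g t - g 0)) with hq
  have hgraph : ∀ t ∈ Icc 0 T, (P t x + conv P g t, q t - g t) ∈ A.graph := by
    intro t ht
    have := A.graph.add_mem (hP.mem_graph_apply ht.1 hx)
      (hP.mem_graph_conv hα₀ hgc hg ht.1 (ht.2.trans_lt hTτ))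
    convert this using 1
    refine Prod.ext rfl ?_
    simp only [hq, Prod.mk_add_mk, _root_.map_add, map_sub]
    abel
  have hhol : ∀ s ∈ Icc 0 T, ∀ t ∈ Icc 0 T, ‖q t - q s‖ ≤
      (1 / α + M * (3 / α + 1 / (1 - α) + 3)) * G * |t - s| ^ α := by
    refine norm_sub_le_of_forall_le fun s t hs hst ht => ?_
    have b1 : ‖P t (v + g 0) - P s (v + g 0)‖ ≤ G * ((t - s) ^ α / α) :=
      hP.norm_sub_le_of_norm_deriv_le hα₀ hα₁.le hG hs hst fun y hy => hv y (hs.trans_lt hy.1)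
    have b2 := hP.norm_singConv_sub_le hα₀ hα₁ hgc hG hg hs hst (ht.trans hTτ.le)
    have e : q t - q s = (P t (v + g 0) - P s (v + g 0)) +
      ((singConv D g t + P t (g t - g 0)) - (singConv D g s + P s (g s - g 0))) := by
      simp only [hq]; abel
    rw [e]
    exact (norm_add_le _ _).trans ((add_le_add b1 b2).trans_eq (by ring))
  refine ⟨q, ?_, hgraph, ?_, hhol⟩
  · simp [hq, singConv, hP.zero_eq_one]
  · refine hasDerivWithinAt_of_right_deriv hT ?_ ?_ ?_
    · exact (hP.continuous_apply continuous_id continuous_const).add (hP.continuous_conv hgc)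
    · exact continuousOn_of_norm_sub_le_rpow hα₀ hhol
    · intro t ht
      rw [← hasDerivWithinAt_Ioi_iff_Ici, hasDerivWithinAt_iff_tendsto_slope' self_notMem_Ioi]
      have hlim := ((hP.isGenerator _ _).1 (hgraph t (Ico_subset_Icc_self ht))).add
        (hP.tendsto_average_conv hgc t)
      rw [sub_add_cancel] at hlim
      have hshift : Tendsto (fun s => s - t) (𝓝[>] t) (𝓝[>] 0) := by
        refine tendsto_nhdsWithin_iff.2 ⟨?_, ?_⟩
        · have : Continuous fun s : ℝ => s - t := by fun_prop
          simpa using (this.tendsto t).mono_left (nhdsWithin_le_nhds (s := Ioi t))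
        · filter_upwards [self_mem_nhdsWithin] with s hs using sub_pos.2 (mem_Ioi.1 hs)
      refine (hlim.comp hshift).congr' ?_
      filter_upwards [self_mem_nhdsWithin] with s hs
      have hs0 : 0 ≤ s - t := sub_nonneg.2 (le_of_lt hs)
      have hadd := hP.conv_add hgc ht.1 hs0
      have hx' := hP.apply_apply hs0 ht.1 x
      rw [add_sub_cancel] at hadd
      rw [sub_add_cancel] at hx'
      simp only [Function.comp_apply, slope, vsub_eq_sub, add_sub_cancel]
      rw [← smul_add, hadd, _root_.map_add, hx']
      congr 1
      abel

/-- The variation of constants formula for classical solutions of `z' = A z + g`. -/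
theorem eq_apply_add_conv [CompleteSpace H] (hP : SmoothingSemigroup A P D τ M) {g z v : ℝ → H}
    {T : ℝ} (hgc : Continuous g) (hz : ∀ t ∈ Icc 0 T, (z t, v t) ∈ A.graph)
    (hd : ∀ t ∈ Icc 0 T, HasDerivWithinAt z (v t + g t) (Icc 0 T) t) {t : ℝ}
    (ht : t ∈ Icc 0 T) : z t = P t (z 0) + conv P g t := by
  have hzc : ContinuousOn z (Icc 0 t) := fun s hs =>
    ((hd s ⟨hs.1, hs.2.trans ht.2⟩).continuousWithinAt).mono (Icc_subset_Icc_right ht.2)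
  have key := intervalIntegral.integral_eq_sub_of_hasDerivAt_of_le
    (f := fun s => P (t - s) (z s)) (f' := fun s => P (t - s) (g s)) ht.1
    (hP.cont.comp_continuousOn ((by fun_prop : ContinuousOn (fun s => t - s) _).prodMk hzc))
    (fun s hs => by
      have hts : 0 < t - s := by linarith [hs.2]
      have hmem : s ∈ Icc 0 T := ⟨hs.1.le, hs.2.le.trans ht.2⟩
      have h1 : HasDerivAt (fun s => P (t - s)) (-D (t - s)) s := by
        simpa [Function.comp_def] using
          (hP.hasDerivAt _ hts).scomp s ((hasDerivAt_id s).const_sub t)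
      have h2 : HasDerivAt z (v s + g s) s :=
        (hd s hmem).hasDerivAt (Icc_mem_nhds hs.1 (hs.2.trans_le ht.2))
      have h3 := h1.clm_apply h2
      refine h3.congr_deriv ?_
      rw [neg_apply, hP.deriv_apply_of_mem_graph hts (hz s hmem),
        _root_.map_add]
      abel)
    (hP.intervalIntegrable_conv hgc _ _ _)
  rw [conv, key]
  simp [hP.zero_eq_one]

end SmoothingSemigroup

/-! ### The delay functional and the linear Volterra equation -/

section

variable {H : Type*} [NormedAddCommGroup H]

/-- The extension `t ↦ y(t) - y(0)` of a continuous function on `[0, T]` to the whole line by `0`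
on the left and by a constant on the right.  Subtracting `y(0)` makes the extension continuous for
every `y`, so that the Volterra operator below is defined on a full function space. -/
noncomputable def zeroExtend {T : ℝ} (hT : 0 ≤ T) (y : C(Icc (0 : ℝ) T, H)) (t : ℝ) : H :=
  y (projIcc 0 T hT t) - y ⟨0, left_mem_Icc.2 hT⟩

theorem continuous_zeroExtend {T : ℝ} (hT : 0 ≤ T) (y : C(Icc (0 : ℝ) T, H)) :
    Continuous (zeroExtend hT y) :=
  (y.continuous.comp continuous_projIcc).sub continuous_const

theorem zeroExtend_of_nonpos {T : ℝ} (hT : 0 ≤ T) (y : C(Icc (0 : ℝ) T, H)) {t : ℝ}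
    (ht : t ≤ 0) : zeroExtend hT y t = 0 := by
  rw [zeroExtend, projIcc_of_le_left hT ht, sub_self]

theorem zeroExtend_of_mem {T : ℝ} (hT : 0 ≤ T) (y : C(Icc (0 : ℝ) T, H)) {t : ℝ}
    (ht : t ∈ Icc 0 T) : zeroExtend hT y t = y ⟨t, ht⟩ - y ⟨0, left_mem_Icc.2 hT⟩ := by
  rw [zeroExtend, projIcc_of_mem hT ht]

theorem norm_zeroExtend_le {T : ℝ} (hT : 0 ≤ T) (y : C(Icc (0 : ℝ) T, H)) (t : ℝ) :
    ‖zeroExtend hT y t‖ ≤ 2 * ‖y‖ := by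
  have h1 := y.norm_coe_le_norm (projIcc 0 T hT t)
  have h2 := y.norm_coe_le_norm ⟨0, left_mem_Icc.2 hT⟩
  exact (norm_sub_le _ _).trans (by linarith)

theorem norm_zeroExtend_le_pow {T : ℝ} (hT : 0 ≤ T) {y : C(Icc (0 : ℝ) T, H)} {c : ℝ} {n : ℕ}
    (hc : 0 ≤ c) (hy : ∀ t, ‖y t‖ ≤ c * (t : ℝ) ^ n) {s t : ℝ} (hst : t ≤ s) (hs : 0 ≤ s) :
    ‖zeroExtend hT y t‖ ≤ 2 * (c * s ^ n) := by
  have h1 : ‖y (projIcc 0 T hT t)‖ ≤ c * s ^ n := by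
    refine (hy _).trans ?_
    have h0 : 0 ≤ (projIcc 0 T hT t : ℝ) := (projIcc 0 T hT t).2.1
    have h2 : (projIcc 0 T hT t : ℝ) ≤ s := by
      rw [coe_projIcc]
      exact max_le hs ((min_le_right _ _).trans hst)
    gcongr
  have h3 : ‖y ⟨0, left_mem_Icc.2 hT⟩‖ ≤ c * s ^ n := by
    refine (hy _).trans ?_
    simp only
    gcongr
  exact (norm_sub_le _ _).trans (by linarith)

variable [InnerProductSpace ℝ H]

/-- The delay functional `u ↦ B₁ u(-r) + ∫_{-r}^0 a(θ) B₀ u(θ) dθ`. -/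
noncomputable def delayFunctional (r : ℝ) (a : ℝ → ℝ) (B₀ B₁ : H →L[ℝ] H) (u : ℝ → H) : H :=
  B₁ (u (-r)) + ∫ θ in (-r)..0, a θ • B₀ (u θ)

/-- A bound for the delay functional with respect to the supremum norm. -/
noncomputable def delayBound (r : ℝ) (a : ℝ → ℝ) (B₀ B₁ : H →L[ℝ] H) : ℝ :=
  ‖B₁‖ + (∫ θ in (-r)..0, |a θ|) * ‖B₀‖

variable {r : ℝ} {a : ℝ → ℝ} {B₀ B₁ : H →L[ℝ] H}

theorem delayBound_nonneg (hr : 0 ≤ r) : 0 ≤ delayBound r a B₀ B₁ := by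
  have : 0 ≤ ∫ θ in (-r)..0, |a θ| :=
    intervalIntegral.integral_nonneg (by linarith) fun _ _ => abs_nonneg _
  unfold delayBound
  positivity

theorem intervalIntegrable_delay (ha : IntervalIntegrable a volume (-r) 0) {u : ℝ → H}
    (hu : Continuous u) : IntervalIntegrable (fun θ => a θ • B₀ (u θ)) volume (-r) 0 :=
  ha.smul_continuousOn (B₀.continuous.comp hu).continuousOn

theorem norm_delayFunctional_le (hr : 0 ≤ r) (ha : IntervalIntegrable a volume (-r) 0)
    {u : ℝ → H} {c : ℝ} (hu : ∀ θ ∈ Icc (-r) 0, ‖u θ‖ ≤ c) :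
    ‖delayFunctional r a B₀ B₁ u‖ ≤ delayBound r a B₀ B₁ * c := by
  have hr' : -r ≤ 0 := by linarith
  have h1 : ‖B₁ (u (-r))‖ ≤ ‖B₁‖ * c := B₁.le_of_opNorm_le_of_le le_rfl (hu _ ⟨le_rfl, hr'⟩)
  have h2 : ‖∫ θ in (-r)..0, a θ • B₀ (u θ)‖ ≤ ∫ θ in (-r)..0, |a θ| * (‖B₀‖ * c) := by
    refine intervalIntegral.norm_integral_le_of_norm_le hr' (Eventually.of_forall
      fun θ hθ => ?_) (ha.abs.mul_const _)
    rw [norm_smul, Real.norm_eq_abs]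
    gcongr
    exact B₀.le_of_opNorm_le_of_le le_rfl (hu _ (Ioc_subset_Icc_self hθ))
  rw [intervalIntegral.integral_mul_const] at h2
  refine (norm_add_le _ _).trans ((add_le_add h1 h2).trans_eq ?_)
  unfold delayBound
  ring

theorem delayFunctional_add (ha : IntervalIntegrable a volume (-r) 0) {u v : ℝ → H}
    (hu : Continuous u) (hv : Continuous v) :
    delayFunctional r a B₀ B₁ (fun θ => u θ + v θ) =
      delayFunctional r a B₀ B₁ u + delayFunctional r a B₀ B₁ v := by
  simp only [delayFunctional, map_add, smul_add]
  rw [intervalIntegral.integral_add (intervalIntegrable_delay ha hu)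
    (intervalIntegrable_delay ha hv)]
  abel

theorem delayFunctional_sub (ha : IntervalIntegrable a volume (-r) 0) {u v : ℝ → H}
    (hu : Continuous u) (hv : Continuous v) :
    delayFunctional r a B₀ B₁ (fun θ => u θ - v θ) =
      delayFunctional r a B₀ B₁ u - delayFunctional r a B₀ B₁ v := by
  simp only [delayFunctional, map_sub, smul_sub]
  rw [intervalIntegral.integral_sub (intervalIntegrable_delay ha hu)
    (intervalIntegrable_delay ha hv)]
  abel

theorem delayFunctional_smul (c : ℝ) (u : ℝ → H) :
    delayFunctional r a B₀ B₁ (fun θ => c • u θ) = c • delayFunctional r a B₀ B₁ u := by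
  simp only [delayFunctional, map_smul, smul_add]
  rw [← intervalIntegral.integral_smul]
  simp only [smul_comm c]

theorem delayFunctional_congr (hr : 0 ≤ r) {u v : ℝ → H} (h : EqOn u v (Icc (-r) 0)) :
    delayFunctional r a B₀ B₁ u = delayFunctional r a B₀ B₁ v := by
  have hr' : -r ≤ 0 := by linarith
  unfold delayFunctional
  rw [h ⟨le_rfl, hr'⟩]
  congr 1
  refine intervalIntegral.integral_congr fun θ hθ => ?_
  rw [uIcc_of_le hr'] at hθ
  simp only [h hθ]

theorem continuous_delayFunctional (ha : IntervalIntegrable a volume (-r) 0) {u : ℝ → H} {c : ℝ}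
    (hu : Continuous u) (hc : ∀ t, ‖u t‖ ≤ c) :
    Continuous fun s => delayFunctional r a B₀ B₁ fun θ => u (s + θ) := by
  refine (B₁.continuous.comp (by fun_prop)).add ?_
  refine intervalIntegral.continuous_of_dominated_interval
    (bound := fun θ => |a θ| * (‖B₀‖ * c)) ?_ ?_ (ha.abs.mul_const _) ?_
  · intro s
    have := (intervalIntegrable_delay (B₀ := B₀) ha
      (show Continuous fun θ => u (s + θ) by fun_prop))
    exact this.def'.aestronglyMeasurable
  · refine fun s => Eventually.of_forall fun θ _ => ?_
    rw [norm_smul, Real.norm_eq_abs]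
    gcongr
    exact B₀.le_of_opNorm_le_of_le le_rfl (hc _)
  · exact Eventually.of_forall fun θ _ => (B₀.continuous.comp (by fun_prop)).const_smul _

/-- `s ↦ delayFunctional (u (s + ·))` inherits the Hölder continuity of `u`. -/
theorem norm_delayFunctional_sub_le (hr : 0 ≤ r) (ha : IntervalIntegrable a volume (-r) 0)
    {u : ℝ → H} {α c : ℝ} (hu : Continuous u) (hc : ∀ s t, ‖u t - u s‖ ≤ c * |t - s| ^ α)
    (s t : ℝ) :
    ‖delayFunctional r a B₀ B₁ (fun θ => u (t + θ)) -
      delayFunctional r a B₀ B₁ fun θ => u (s + θ)‖ ≤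
      delayBound r a B₀ B₁ * c * |t - s| ^ α := by
  rw [← delayFunctional_sub ha (by fun_prop) (by fun_prop), mul_assoc]
  refine norm_delayFunctional_le hr ha fun θ _ => ?_
  simpa using hc (s + θ) (t + θ)

/-- The inhomogeneity `s ↦ delayFunctional (y (s + ·))` produced by `y` with zero history. -/
noncomputable def delayForcing (r : ℝ) (a : ℝ → ℝ) (B₀ B₁ : H →L[ℝ] H) {T : ℝ} (hT : 0 ≤ T)
    (y : C(Icc (0 : ℝ) T, H)) (s : ℝ) : H :=
  delayFunctional r a B₀ B₁ fun θ => zeroExtend hT y (s + θ)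

theorem continuous_delayForcing (ha : IntervalIntegrable a volume (-r) 0) {T : ℝ} (hT : 0 ≤ T)
    (y : C(Icc (0 : ℝ) T, H)) : Continuous (delayForcing r a B₀ B₁ hT y) :=
  continuous_delayFunctional ha (continuous_zeroExtend hT y) (norm_zeroExtend_le hT y)

theorem delayForcing_add (ha : IntervalIntegrable a volume (-r) 0) {T : ℝ} (hT : 0 ≤ T)
    (y z : C(Icc (0 : ℝ) T, H)) (s : ℝ) : delayForcing r a B₀ B₁ hT (y + z) s =
      delayForcing r a B₀ B₁ hT y s + delayForcing r a B₀ B₁ hT z s := by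
  have hy := continuous_zeroExtend hT y
  have hz := continuous_zeroExtend hT z
  rw [delayForcing, delayForcing, delayForcing,
    ← delayFunctional_add ha (by fun_prop) (by fun_prop)]
  congr 1 with θ
  simp only [zeroExtend, ContinuousMap.add_apply]
  abel

theorem delayForcing_smul {T : ℝ} (hT : 0 ≤ T) (c : ℝ) (y : C(Icc (0 : ℝ) T, H)) (s : ℝ) :
    delayForcing r a B₀ B₁ hT (c • y) s = c • delayForcing r a B₀ B₁ hT y s := by
  rw [delayForcing, delayForcing, ← delayFunctional_smul]
  congr 1 with θ
  simp only [zeroExtend, ContinuousMap.smul_apply, smul_sub]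

end

namespace SmoothingSemigroup

variable {H : Type*} [NormedAddCommGroup H] [InnerProductSpace ℝ H]
  {A : H →ₗ.[ℝ] H} {P D : ℝ → H →L[ℝ] H} {τ M : ℝ}
  {r : ℝ} {a : ℝ → ℝ} {B₀ B₁ : H →L[ℝ] H}

theorem conv_fun_add (hP : SmoothingSemigroup A P D τ M) {g k : ℝ → H} (hg : Continuous g)
    (hk : Continuous k) (t : ℝ) : conv P (fun s => g s + k s) t = conv P g t + conv P k t := by
  simp only [conv, _root_.map_add]
  exact intervalIntegral.integral_add (hP.intervalIntegrable_conv hg _ _ _)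
    (hP.intervalIntegrable_conv hk _ _ _)

/-- The Volterra operator `(V y)(t) = ∫₀ᵗ P(t - s) L(y_s) ds` on `C([0, T]; H)`, where `L` is the
delay functional and `y_s` is the history segment of `y` with zero history. -/
noncomputable def volterra (hP : SmoothingSemigroup A P D τ M) (hr : 0 ≤ r)
    (ha : IntervalIntegrable a volume (-r) 0) (B₀ B₁ : H →L[ℝ] H) {T : ℝ} (hT : 0 ≤ T)
    (hTτ : T ≤ τ) : C(Icc (0 : ℝ) T, H) →L[ℝ] C(Icc (0 : ℝ) T, H) :=
  LinearMap.mkContinuous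
    { toFun := fun y => ⟨fun t => conv P (delayForcing r a B₀ B₁ hT y) t,
        (hP.continuous_conv (continuous_delayForcing ha hT y)).comp continuous_subtype_val⟩
      map_add' := fun y z => by
        ext t
        simp only [ContinuousMap.coe_mk, ContinuousMap.add_apply]
        rw [← hP.conv_fun_add (continuous_delayForcing ha hT y) (continuous_delayForcing ha hT z)]
        congr 1 with s
        exact delayForcing_add ha hT y z s
      map_smul' := fun c y => by
        ext t
        simp only [ContinuousMap.coe_mk, ContinuousMap.smul_apply, RingHom.id_apply, conv]
        rw [← intervalIntegral.integral_smul]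
        congr 1 with s
        rw [delayForcing_smul, map_smul] }
    (M * (delayBound r a B₀ B₁ * 2) * T) fun y => by
      have hM := hP.M_nonneg
      have hl : 0 ≤ delayBound r a B₀ B₁ := delayBound_nonneg hr
      rw [ContinuousMap.norm_le _ (by positivity)]
      intro t
      refine (hP.norm_conv_le t.2.1 (t.2.2.trans hTτ) fun s _ =>
        norm_delayFunctional_le hr ha fun θ _ => norm_zeroExtend_le hT y _).trans ?_
      calc M * (delayBound r a B₀ B₁ * (2 * ‖y‖)) * t
          ≤ M * (delayBound r a B₀ B₁ * (2 * ‖y‖)) * T := by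
            gcongr
            exact t.2.2
        _ = _ := by ring

theorem volterra_apply (hP : SmoothingSemigroup A P D τ M) (hr : 0 ≤ r)
    (ha : IntervalIntegrable a volume (-r) 0) {T : ℝ} (hT : 0 ≤ T) (hTτ : T ≤ τ)
    (y : C(Icc (0 : ℝ) T, H)) (t : Icc (0 : ℝ) T) :
    hP.volterra hr ha B₀ B₁ hT hTτ y t = conv P (delayForcing r a B₀ B₁ hT y) t := rfl

theorem norm_volterra_le_pow (hP : SmoothingSemigroup A P D τ M) (hr : 0 ≤ r)
    (ha : IntervalIntegrable a volume (-r) 0) {T : ℝ} (hT : 0 ≤ T) (hTτ : T ≤ τ)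
    {y : C(Icc (0 : ℝ) T, H)} {c : ℝ} {n : ℕ} (hc : 0 ≤ c)
    (hy : ∀ t, ‖y t‖ ≤ c * (t : ℝ) ^ n) (t : Icc (0 : ℝ) T) :
    ‖hP.volterra hr ha B₀ B₁ hT hTτ y t‖ ≤
      M * delayBound r a B₀ B₁ * 2 * c / (n + 1) * (t : ℝ) ^ (n + 1) := by
  have hM := hP.M_nonneg
  rw [volterra_apply, conv]
  refine (intervalIntegral.norm_integral_le_of_norm_le
    (g := fun s => M * delayBound r a B₀ B₁ * 2 * c * s ^ n) t.2.1
    (Eventually.of_forall fun s hs => ?_) (Continuous.intervalIntegrable (by fun_prop) _ _)).trans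
    ?_
  · refine ((P _).le_of_opNorm_le_of_le (hP.norm_le _ (by linarith [hs.1, t.2.2]))
      (norm_delayFunctional_le hr ha (c := 2 * (c * s ^ n)) fun θ hθ => ?_)).trans_eq (by ring)
    exact norm_zeroExtend_le_pow hT hc hy (by linarith [hθ.2]) hs.1.le
  · rw [intervalIntegral.integral_const_mul, integral_pow]
    refine le_of_eq ?_
    rw [zero_pow (Nat.succ_ne_zero n), sub_zero]
    ring

/-- A fixed point theorem for affine maps: if the powers of `V` are summable, `z = y₀ + V z` is
solved uniquely by the Neumann series `∑ Vⁿ y₀`. -/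
theorem _root_.exists_solution_of_summable_pow {E : Type*} [NormedAddCommGroup E]
    [NormedSpace ℝ E] [CompleteSpace E] (V : E →L[ℝ] E) {b : ℕ → ℝ} (hb : Summable b)
    (h : ∀ n, ‖V ^ n‖ ≤ b n) :
    ∃ K : ℝ, 0 ≤ K ∧ ∀ y₀ : E, ∃ y : E, ‖y‖ ≤ K * ‖y₀‖ ∧ ∀ z, z = y₀ + V z ↔ z = y := by
  have hsum : Summable fun n : ℕ => V ^ n := Summable.of_norm_bounded hb h
  set R := ∑' n : ℕ, V ^ n
  have h1 : R * (1 - V) = 1 := hsum.tsum_pow_mul_one_sub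
  have h2 : (1 - V) * R = 1 := hsum.one_sub_mul_tsum_pow
  refine ⟨‖R‖, norm_nonneg _, fun y₀ => ⟨R y₀, R.le_opNorm y₀, fun z => ?_⟩⟩
  have hz : z = y₀ + V z ↔ (1 - V) z = y₀ := by
    rw [← sub_eq_iff_eq_add]; rfl
  rw [hz]
  constructor
  · rintro rfl
    exact (congrArg (fun L => L z) h1).symm
  · rintro rfl
    exact congrArg (fun L => L y₀) h2

theorem norm_volterra_pow_apply_le (hP : SmoothingSemigroup A P D τ M) (hr : 0 ≤ r)
    (ha : IntervalIntegrable a volume (-r) 0) {T : ℝ} (hT : 0 ≤ T) (hTτ : T ≤ τ) (n : ℕ)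
    (y : C(Icc (0 : ℝ) T, H)) (t : Icc (0 : ℝ) T) :
    ‖(hP.volterra hr ha B₀ B₁ hT hTτ ^ n) y t‖ ≤
      ‖y‖ * (M * delayBound r a B₀ B₁ * 2) ^ n / (n.factorial : ℝ) * (t : ℝ) ^ n := by
  have hM := hP.M_nonneg
  have hl : 0 ≤ delayBound r a B₀ B₁ := delayBound_nonneg hr
  induction n generalizing t with
  | zero => simpa using y.norm_coe_le_norm t
  | succ n ih =>
    rw [pow_succ']
    refine (hP.norm_volterra_le_pow hr ha hT hTτ (by positivity) ih t).trans_eq ?_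
    rw [Nat.factorial_succ]
    push_cast
    field_simp
    ring

/-- The equation `z = y₀ + V z` is uniquely solvable, since `‖V ^ n‖ ≤ (k T) ^ n / n!`. -/
theorem exists_volterra_solution [CompleteSpace H] (hP : SmoothingSemigroup A P D τ M)
    (hr : 0 ≤ r) (ha : IntervalIntegrable a volume (-r) 0) (B₀ B₁ : H →L[ℝ] H) {T : ℝ}
    (hT : 0 ≤ T) (hTτ : T ≤ τ) :
    ∃ K : ℝ, 0 ≤ K ∧ ∀ y₀ : C(Icc (0 : ℝ) T, H), ∃ y : C(Icc (0 : ℝ) T, H),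
      ‖y‖ ≤ K * ‖y₀‖ ∧ ∀ z, z = y₀ + hP.volterra hr ha B₀ B₁ hT hTτ z ↔ z = y := by
  have hM := hP.M_nonneg
  have hl : 0 ≤ delayBound r a B₀ B₁ := delayBound_nonneg hr
  refine exists_solution_of_summable_pow _
    (Real.summable_pow_div_factorial (M * delayBound r a B₀ B₁ * 2 * T)) fun n => ?_
  refine ContinuousLinearMap.opNorm_le_bound _ (by positivity) fun y => ?_
  rw [ContinuousMap.norm_le _ (by positivity)]
  intro t
  refine (hP.norm_volterra_pow_apply_le hr ha hT hTτ n y t).trans ?_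
  have h0 := t.2.1
  calc ‖y‖ * (M * delayBound r a B₀ B₁ * 2) ^ n / (n.factorial : ℝ) * (t : ℝ) ^ n
      ≤ ‖y‖ * (M * delayBound r a B₀ B₁ * 2) ^ n / (n.factorial : ℝ) * T ^ n := by
        gcongr
        exact t.2.2
    _ = _ := by rw [mul_pow _ T]; ring

end SmoothingSemigroup

/-! ### The delay equation -/

section

variable {E : Type*} [NormedAddCommGroup E]

theorem norm_projIcc_sub_le {u : ℝ → E} {a b c α : ℝ} (hab : a ≤ b) (hα : 0 ≤ α) (hc : 0 ≤ c)
    (h : ∀ s ∈ Icc a b, ∀ t ∈ Icc a b, ‖u t - u s‖ ≤ c * |t - s| ^ α) (s t : ℝ) :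
    ‖u (projIcc a b hab t) - u (projIcc a b hab s)‖ ≤ c * |t - s| ^ α := by
  refine (h _ (projIcc a b hab s).2 _ (projIcc a b hab t).2).trans ?_
  have := abs_projIcc_sub_projIcc (c := t) (d := s) hab
  gcongr

end

namespace SmoothingSemigroup

variable {H : Type*} [NormedAddCommGroup H] [InnerProductSpace ℝ H]
  {A : H →ₗ.[ℝ] H} {P D : ℝ → H →L[ℝ] H} {τ M : ℝ}
  {r : ℝ} {a : ℝ → ℝ} {B₀ B₁ : H →L[ℝ] H}

/-- The inhomogeneity of the Cauchy problem on `[0, T]` that is produced by the history `φ` and by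
a continuous function `y` on `[0, T]`. -/
noncomputable def totalForcing (r : ℝ) (a : ℝ → ℝ) (B₀ B₁ : H →L[ℝ] H) {T : ℝ} (hT : 0 ≤ T)
    (f φ : ℝ → H) (y : C(Icc (0 : ℝ) T, H)) (s : ℝ) : H :=
  delayFunctional r a B₀ B₁ (fun θ => φ (s + θ) + zeroExtend hT y (s + θ)) + f s

theorem totalForcing_eq (ha : IntervalIntegrable a volume (-r) 0) {T : ℝ} (hT : 0 ≤ T)
    {f φ : ℝ → H} (hφ : Continuous φ) (y : C(Icc (0 : ℝ) T, H)) (s : ℝ) :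
    totalForcing r a B₀ B₁ hT f φ y s =
      (delayFunctional r a B₀ B₁ (fun θ => φ (s + θ)) + f s) + delayForcing r a B₀ B₁ hT y s := by
  have := continuous_zeroExtend hT y
  rw [totalForcing, delayFunctional_add ha (by fun_prop) (by fun_prop), delayForcing]
  abel

/-- Existence, uniqueness and a bound for mild solutions, that is, for solutions of the variation
of constants formula. -/
theorem exists_mild_solution [CompleteSpace H] (hP : SmoothingSemigroup A P D τ M)
    (hr : 0 ≤ r) (ha : IntervalIntegrable a volume (-r) 0) (B₀ B₁ : H →L[ℝ] H) {T : ℝ}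
    (hT : 0 ≤ T) (hTτ : T ≤ τ) :
    ∃ K : ℝ, 0 ≤ K ∧ ∀ (N : ℝ) (f φ : ℝ → H) (x : H), Continuous f → Continuous φ →
      (∀ t, ‖f t‖ ≤ N) → (∀ t, ‖φ t‖ ≤ N) → ‖x‖ ≤ N →
      ∃ y : C(Icc (0 : ℝ) T, H), ‖y‖ ≤ K * N ∧ ∀ z : C(Icc (0 : ℝ) T, H),
        (∀ t : Icc (0 : ℝ) T, z t = P t x + conv P (totalForcing r a B₀ B₁ hT f φ z) t) ↔
          z = y := by
  have hM := hP.M_nonneg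
  have hl : 0 ≤ delayBound r a B₀ B₁ := delayBound_nonneg hr
  obtain ⟨K, hK, hsol⟩ := hP.exists_volterra_solution hr ha B₀ B₁ hT hTτ
  refine ⟨K * (M + M * (delayBound r a B₀ B₁ + 1) * T), by positivity, ?_⟩
  intro N f φ x hf hφ hfN hφN hxN
  have hN : 0 ≤ N := (norm_nonneg _).trans hxN
  set g : ℝ → H := fun s => delayFunctional r a B₀ B₁ (fun θ => φ (s + θ)) + f s with hg
  have hgc : Continuous g := (continuous_delayFunctional ha hφ hφN).add hf
  have hgN : ∀ s, ‖g s‖ ≤ (delayBound r a B₀ B₁ + 1) * N := fun s => by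
    refine (norm_add_le _ _).trans ((add_le_add
      (norm_delayFunctional_le hr ha fun θ _ => hφN (s + θ)) (hfN s)).trans_eq (by ring))
  let y₀ : C(Icc (0 : ℝ) T, H) := ⟨fun t => P t x + conv P g t,
    (hP.continuous_apply continuous_subtype_val continuous_const).add
      ((hP.continuous_conv hgc).comp continuous_subtype_val)⟩
  obtain ⟨y, hyN, hy⟩ := hsol y₀
  refine ⟨y, hyN.trans ?_, fun z => ?_⟩
  · have : ‖y₀‖ ≤ (M + M * (delayBound r a B₀ B₁ + 1) * T) * N := by
      rw [ContinuousMap.norm_le _ (by positivity)]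
      intro t
      have h1 : ‖P t x‖ ≤ M * N :=
        (P t).le_of_opNorm_le_of_le (hP.norm_le _ (t.2.2.trans hTτ)) hxN
      have h2 : ‖conv P g t‖ ≤ M * ((delayBound r a B₀ B₁ + 1) * N) * T :=
        (hP.norm_conv_le t.2.1 (t.2.2.trans hTτ) fun s _ => hgN s).trans (by
          gcongr
          exact t.2.2)
      exact (norm_add_le _ _).trans ((add_le_add h1 h2).trans_eq (by ring))
    rw [mul_assoc]
    gcongr
  · rw [← hy z, ContinuousMap.ext_iff]
    refine forall_congr' fun t => ?_
    have : conv P (totalForcing r a B₀ B₁ hT f φ z) t =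
        conv P g t + conv P (delayForcing r a B₀ B₁ hT z) t := by
      rw [← hP.conv_fun_add hgc (continuous_delayForcing ha hT z)]
      congr 1 with s
      exact totalForcing_eq ha hT hφ z s
    rw [this, ContinuousMap.add_apply, volterra_apply, ← add_assoc]
    rfl

/-- Mild solutions are Hölder continuous when the initial value lies in the domain of the
generator and the inhomogeneity is bounded. -/
theorem norm_mild_sub_le [CompleteSpace H] (hP : SmoothingSemigroup A P D τ M) {g : ℝ → H}
    {α B N T s t : ℝ} {x v : H} (hα₀ : 0 < α) (hα₁ : α < 1) (hgc : Continuous g)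
    (hg : ∀ s, ‖g s‖ ≤ B) (hx : (x, v) ∈ A.graph) (hv : ‖v‖ ≤ N) (hs : 0 ≤ s) (hst : s ≤ t)
    (htT : t ≤ T) (hTτ : T ≤ τ) :
    ‖(P t x + conv P g t) - (P s x + conv P g s)‖ ≤
      (M * N * T ^ (1 - α) / α +
        M * B * τ ^ (1 - α) * (1 / (α * (1 - α)) + 1)) * (t - s) ^ α := by
  have hM := hP.M_nonneg
  have hN : 0 ≤ N := (norm_nonneg _).trans hv
  have hT : 0 ≤ T := hs.trans (hst.trans htT)
  have h1 : ‖P t x - P s x‖ ≤ M * N * T ^ (1 - α) * ((t - s) ^ α / α) := by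
    refine hP.norm_sub_le_of_norm_deriv_le hα₀ hα₁.le (by positivity) hs hst fun y hy => ?_
    have hy0 : 0 < y := hs.trans_lt hy.1
    have hyT : y ≤ T := hy.2.le.trans htT
    rw [hP.deriv_apply_of_mem_graph hy0 hx]
    refine ((P y).le_of_opNorm_le_of_le (hP.norm_le y (hyT.trans hTτ)) hv).trans ?_
    have h2 : 1 ≤ T ^ (1 - α) * y ^ (α - 1) := by
      calc (1 : ℝ) = y ^ (1 - α) * y ^ (α - 1) := by
            rw [← Real.rpow_add hy0]; simp
        _ ≤ _ := by gcongr
    calc M * N = M * N * 1 := by ring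
      _ ≤ M * N * (T ^ (1 - α) * y ^ (α - 1)) := by gcongr
      _ = _ := by ring
  have h2 := hP.norm_conv_sub_le hα₀ hα₁ hgc hg hs hst (htT.trans hTτ)
  rw [add_sub_add_comm]
  exact (norm_add_le _ _).trans ((add_le_add h1 h2).trans_eq (by ring))

/-- The delay equation in terms of the graph of `A`, with one real number `N` bounding all data and
one constant `K` for all estimates.  The mild solution is Hölder continuous by the smoothing of the
semigroup; its delay terms are then an admissible Hölder continuous inhomogeneity, and maximal
regularity applies. -/
theorem exists_delay_solution [CompleteSpace H] (hP : SmoothingSemigroup A P D τ M)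
    {α T : ℝ} (hα₀ : 0 < α) (hα₁ : α < 1) (hr : 0 ≤ r) (hT : 0 ≤ T) (hTτ : T < τ)
    (ha : IntervalIntegrable a volume (-r) 0) (B₀ B₁ : H →L[ℝ] H) :
    ∃ K : ℝ, 0 ≤ K ∧ ∀ (N : ℝ) (f φ : ℝ → H) (v : H),
      (∀ t ∈ Icc 0 T, ‖f t‖ ≤ N) →
      (∀ s ∈ Icc 0 T, ∀ t ∈ Icc 0 T, ‖f t - f s‖ ≤ N * |t - s| ^ α) →
      (∀ t ∈ Icc (-r) 0, ‖φ t‖ ≤ N) →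
      (∀ s ∈ Icc (-r) 0, ∀ t ∈ Icc (-r) 0, ‖φ t - φ s‖ ≤ N * |t - s| ^ α) →
      (φ 0, v) ∈ A.graph → ‖v‖ ≤ N →
      ‖v + (delayFunctional r a B₀ B₁ φ + f 0)‖ ≤ N →
      (∀ t, 0 < t → ‖D t (v + (delayFunctional r a B₀ B₁ φ + f 0))‖ ≤ N * t ^ (α - 1)) →
      ∃ y p q : ℝ → H, EqOn y φ (Icc (-r) 0) ∧
        (∀ t ∈ Icc 0 T, (y t, p t) ∈ A.graph) ∧
        (∀ t ∈ Icc 0 T, q t = p t + (delayFunctional r a B₀ B₁ (fun θ => y (t + θ)) + f t)) ∧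
        (∀ t ∈ Icc 0 T, HasDerivWithinAt y (q t) (Icc 0 T) t) ∧
        (∀ t ∈ Icc 0 T, ‖y t‖ ≤ K * N ∧ ‖p t‖ ≤ K * N ∧ ‖q t‖ ≤ K * N) ∧
        (∀ s ∈ Icc 0 T, ∀ t ∈ Icc 0 T, ‖y t - y s‖ ≤ K * N * |t - s| ^ α ∧
          ‖p t - p s‖ ≤ K * N * |t - s| ^ α ∧ ‖q t - q s‖ ≤ K * N * |t - s| ^ α) ∧
        ∀ z w : ℝ → H, EqOn z φ (Icc (-r) 0) → (∀ t ∈ Icc 0 T, (z t, w t) ∈ A.graph) →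
          (∀ t ∈ Icc 0 T, HasDerivWithinAt z
            (w t + (delayFunctional r a B₀ B₁ (fun θ => z (t + θ)) + f t)) (Icc 0 T) t) →
          EqOn z y (Icc (-r) T) := by
  have hM := hP.M_nonneg
  have hl : 0 ≤ delayBound r a B₀ B₁ := delayBound_nonneg hr
  have hr' : -r ≤ 0 := by linarith
  have hτ : 0 ≤ τ := hT.trans hTτ.le
  have h1α : 0 < 1 - α := by linarith
  have h0T : (0 : ℝ) ∈ Icc 0 T := left_mem_Icc.2 hT
  set l := delayBound r a B₀ B₁
  obtain ⟨K₁, hK₁, hmild⟩ := hP.exists_mild_solution hr ha B₀ B₁ hT hTτ.le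
  obtain ⟨K₂, hK₂, hmax⟩ := hP.exists_maximal_regularity hα₀ hα₁ hT hTτ
  -- `B N` bounds the inhomogeneity; `Cy N`, `Cg N`, `Cq N` are Hölder constants for the mild
  -- solution, the inhomogeneity and the derivative of the solution
  obtain ⟨B, hB0, hB⟩ : ∃ B, 0 ≤ B ∧ B = l * (1 + 2 * K₁) + 1 := ⟨_, by positivity, rfl⟩
  obtain ⟨Cy, hCy0, hCy⟩ : ∃ C, 0 ≤ C ∧ C = M * T ^ (1 - α) / α +
      M * B * τ ^ (1 - α) * (1 / (α * (1 - α)) + 1) := ⟨_, by positivity, rfl⟩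
  obtain ⟨Cg, hCg0, hCg⟩ : ∃ C, 0 ≤ C ∧ C = l * (1 + Cy) + 1 := ⟨_, by positivity, rfl⟩
  obtain ⟨Cq, hCq0, hCq⟩ : ∃ C, 0 ≤ C ∧ C = K₂ * Cg := ⟨_, by positivity, rfl⟩
  have hTα : 0 ≤ T ^ α := Real.rpow_nonneg hT _
  refine ⟨K₁ + B + Cy + Cg + Cq + 1 + Cq * T ^ α, by positivity, ?_⟩
  intro N f φ v hfN hfα hφN hφα hx hv hh₀ hDh₀
  have hN : 0 ≤ N := (norm_nonneg _).trans hv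
  set F : ℝ → H := fun t => f (projIcc 0 T hT t) with hF
  set Φ : ℝ → H := fun t => φ (projIcc (-r) 0 hr' t) with hΦ
  have hFα : ∀ s t, ‖F t - F s‖ ≤ N * |t - s| ^ α := norm_projIcc_sub_le hT hα₀.le hN hfα
  have hΦα : ∀ s t, ‖Φ t - Φ s‖ ≤ N * |t - s| ^ α := norm_projIcc_sub_le hr' hα₀.le hN hφα
  have hFc : Continuous F := continuous_of_norm_sub_le_rpow hα₀ hFα
  have hΦc : Continuous Φ := continuous_of_norm_sub_le_rpow hα₀ hΦα
  have hFN : ∀ t, ‖F t‖ ≤ N := fun t => hfN _ (projIcc 0 T hT t).2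
  have hΦN : ∀ t, ‖Φ t‖ ≤ N := fun t => hφN _ (projIcc (-r) 0 hr' t).2
  have hFf : ∀ t ∈ Icc 0 T, F t = f t := fun t ht => by simp only [hF, projIcc_of_mem hT ht]
  have hΦφ : ∀ t ∈ Icc (-r) 0, Φ t = φ t := fun t ht => by
    simp only [hΦ, projIcc_of_mem hr' ht]
  have hΦ0 : ∀ t, 0 ≤ t → Φ t = φ 0 := fun t ht => by
    simp only [hΦ, projIcc_of_right_le hr' ht]
  have hφ0N : ‖φ 0‖ ≤ N := hφN 0 (right_mem_Icc.2 hr')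
  obtain ⟨y, hyN, hy⟩ := hmild N F Φ (φ 0) hFc hΦc hFN hΦN hφ0N
  -- a function with initial value `φ 0`, continued by the history `φ`
  have hext : ∀ (z : C(Icc (0 : ℝ) T, H)) (Z : ℝ → H), z ⟨0, h0T⟩ = φ 0 →
      EqOn Z φ (Icc (-r) 0) → (∀ t : Icc (0 : ℝ) T, Z t = z t) →
      ∀ t ∈ Icc (-r) T, Φ t + zeroExtend hT z t = Z t := by
    intro z Z hz0 hZφ hZz t ht
    rcases le_total t 0 with h | h
    · rw [zeroExtend_of_nonpos hT z h, add_zero, hΦφ t ⟨ht.1, h⟩, hZφ ⟨ht.1, h⟩]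
    · rw [hΦ0 t h, zeroExtend_of_mem hT z ⟨h, ht.2⟩, hz0, hZz ⟨t, h, ht.2⟩]
      abel
  have hforce : ∀ (z : C(Icc (0 : ℝ) T, H)) (Z : ℝ → H),
      (∀ t ∈ Icc (-r) T, Φ t + zeroExtend hT z t = Z t) → ∀ t ∈ Icc 0 T,
      totalForcing r a B₀ B₁ hT F Φ z t =
        delayFunctional r a B₀ B₁ (fun θ => Z (t + θ)) + f t := by
    intro z Z hZ t ht
    rw [totalForcing, hFf t ht]
    congr 1
    exact delayFunctional_congr hr fun θ hθ =>
      hZ _ ⟨by linarith [hθ.1, ht.1], by linarith [hθ.2, ht.2]⟩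
  have hforce_cont : ∀ z : C(Icc (0 : ℝ) T, H),
      Continuous (totalForcing r a B₀ B₁ hT F Φ z) := by
    intro z
    have h1 := continuous_zeroExtend hT z
    refine (continuous_delayFunctional ha (hΦc.add h1) (c := N + 2 * ‖z‖) fun t => ?_).add hFc
    exact (norm_add_le _ _).trans (add_le_add (hΦN t) (norm_zeroExtend_le hT z t))
  set g := totalForcing r a B₀ B₁ hT F Φ y with hg
  have hgc : Continuous g := hforce_cont y
  have hgN : ∀ s, ‖g s‖ ≤ B * N := by
    intro s
    have h1 : ∀ θ ∈ Icc (-r) 0, ‖Φ (s + θ) + zeroExtend hT y (s + θ)‖ ≤ (1 + 2 * K₁) * N :=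
      fun θ _ => by
        have := norm_zeroExtend_le hT y (s + θ)
        refine (norm_add_le _ _).trans ?_
        linarith [hΦN (s + θ)]
    refine (norm_add_le _ _).trans ((add_le_add (norm_delayFunctional_le hr ha h1)
      (hFN s)).trans_eq ?_)
    rw [hB]; ring
  have hyeq : ∀ t : Icc (0 : ℝ) T, y t = P t (φ 0) + conv P g t := (hy y).2 rfl
  have hy0 : y ⟨0, h0T⟩ = φ 0 := by
    rw [hyeq]; simp [conv, hP.zero_eq_one]
  set Y : ℝ → H := fun t => Φ t + zeroExtend hT y t with hY
  have hYφ : EqOn Y φ (Icc (-r) 0) := fun t ht => by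
    simp only [hY]
    rw [zeroExtend_of_nonpos hT y ht.2, add_zero, hΦφ t ht]
  have hYy : ∀ t : Icc (0 : ℝ) T, Y t = y t := fun t => by
    simp only [hY]
    rw [zeroExtend_of_mem hT y t.2, hΦ0 t t.2.1, hy0]
    abel
  have hYmild : ∀ t ∈ Icc 0 T, Y t = P t (φ 0) + conv P g t := fun t ht =>
    (hYy ⟨t, ht⟩).trans (hyeq ⟨t, ht⟩)
  have hgY : ∀ t ∈ Icc 0 T,
      g t = delayFunctional r a B₀ B₁ (fun θ => Y (t + θ)) + f t :=
    hforce y Y fun _ _ => rfl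
  have hYα : ∀ s ∈ Icc 0 T, ∀ t ∈ Icc 0 T, ‖Y t - Y s‖ ≤ Cy * N * |t - s| ^ α := by
    refine norm_sub_le_of_forall_le fun s t hs hst ht => ?_
    rw [hYmild s ⟨hs, hst.trans ht⟩, hYmild t ⟨hs.trans hst, ht⟩]
    refine (hP.norm_mild_sub_le hα₀ hα₁ hgc hgN hx hv hs hst ht hTτ.le).trans_eq ?_
    rw [hCy]; ring
  have hEα : ∀ s t, ‖zeroExtend hT y t - zeroExtend hT y s‖ ≤ Cy * N * |t - s| ^ α := by
    intro s t
    have := norm_projIcc_sub_le hT hα₀.le (by positivity) hYα s t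
    rw [hYy, hYy] at this
    simpa [zeroExtend] using this
  have hYα' : ∀ s t, ‖Y t - Y s‖ ≤ (1 + Cy) * N * |t - s| ^ α := by
    intro s t
    simp only [hY]
    rw [add_sub_add_comm]
    exact (norm_add_le _ _).trans ((add_le_add (hΦα s t) (hEα s t)).trans_eq (by ring))
  have hgα : ∀ s t, ‖g t - g s‖ ≤ Cg * N * |t - s| ^ α := by
    intro s t
    have h1 := norm_delayFunctional_sub_le (B₀ := B₀) (B₁ := B₁) hr ha
      (hΦc.add (continuous_zeroExtend hT y)) hYα' s t
    simp only [hg, totalForcing]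
    rw [add_sub_add_comm]
    refine (norm_add_le _ _).trans ((add_le_add h1 (hFα s t)).trans_eq ?_)
    rw [hCg]; ring
  have hg0 : g 0 = delayFunctional r a B₀ B₁ φ + f 0 := by
    rw [hgY 0 h0T]
    congr 1
    exact delayFunctional_congr hr fun θ hθ => by simpa using hYφ hθ
  obtain ⟨q, hq0, hqg, hqd, hqα⟩ := hmax g (φ 0) v (Cg * N) hgc hx hgα fun t ht => by
    rw [hg0]
    refine (hDh₀ t ht).trans ?_
    have h1 : 0 ≤ l * (1 + Cy) * N := by positivity
    have h2 : N ≤ Cg * N := by rw [hCg]; linarith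
    gcongr
  rw [← mul_assoc, ← hCq] at hqα
  have hqN : ∀ t ∈ Icc 0 T, ‖q t‖ ≤ (1 + Cq * T ^ α) * N := by
    intro t ht
    have h1 := hqα 0 h0T t ht
    rw [sub_zero, abs_of_nonneg ht.1] at h1
    have h2 : t ^ α ≤ T ^ α := Real.rpow_le_rpow ht.1 ht.2 hα₀.le
    have h3 : ‖q 0‖ ≤ N := by rw [hq0, hg0]; exact hh₀
    have h4 : Cq * N * t ^ α ≤ Cq * N * T ^ α := by gcongr
    have h5 : ‖q t‖ ≤ ‖q t - q 0‖ + ‖q 0‖ := by simpa using norm_add_le (q t - q 0) (q 0)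
    linarith
  have hmono : ∀ {c w : ℝ}, c ≤ K₁ + B + Cy + Cg + Cq + 1 + Cq * T ^ α → 0 ≤ w →
      c * N * w ≤ (K₁ + B + Cy + Cg + Cq + 1 + Cq * T ^ α) * N * w := fun h hw => by gcongr
  have hmono1 : ∀ {c : ℝ}, c ≤ K₁ + B + Cy + Cg + Cq + 1 + Cq * T ^ α →
      c * N ≤ (K₁ + B + Cy + Cg + Cq + 1 + Cq * T ^ α) * N := fun h => by gcongr
  have hCT : 0 ≤ Cq * T ^ α := by positivity
  refine ⟨Y, fun t => q t - g t, q, hYφ, ?_, ?_, ?_, ?_, ?_, ?_⟩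
  · intro t ht
    rw [hYmild t ht]
    exact hqg t ht
  · intro t ht
    simp only
    rw [← hgY t ht, sub_add_cancel]
  · intro t ht
    exact (hqd t ht).congr hYmild (hYmild t ht)
  · intro t ht
    refine ⟨?_, ?_, ?_⟩
    · rw [hYy ⟨t, ht⟩]
      exact (y.norm_coe_le_norm _).trans (hyN.trans (hmono1 (by linarith)))
    · refine (norm_sub_le _ _).trans ((add_le_add (hqN t ht) (hgN t)).trans ?_)
      rw [← add_mul]
      exact hmono1 (by linarith)
    · exact (hqN t ht).trans (hmono1 (by linarith))
  · intro s hs t ht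
    have hw : 0 ≤ |t - s| ^ α := Real.rpow_nonneg (abs_nonneg _) _
    refine ⟨(hYα s hs t ht).trans (hmono (by linarith) hw), ?_,
      (hqα s hs t ht).trans (hmono (by linarith) hw)⟩
    rw [sub_sub_sub_comm]
    refine (norm_sub_le _ _).trans ((add_le_add (hqα s hs t ht) (hgα s t)).trans ?_)
    rw [← add_mul, ← add_mul]
    exact hmono (by linarith) hw
  · intro z w hzφ hzw hzd
    have hzc : ContinuousOn z (Icc 0 T) := fun t ht => (hzd t ht).continuousWithinAt
    let z' : C(Icc (0 : ℝ) T, H) := ⟨fun t => z t, continuousOn_iff_continuous_domRestrict.1 hzc⟩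
    have hz0 : z 0 = φ 0 := hzφ (right_mem_Icc.2 hr')
    have hz := hext z' z hz0 hzφ fun _ => rfl
    have hvoc := fun t ht => hP.eq_apply_add_conv (t := t) (hforce_cont z') hzw (fun t ht => by
      rw [hforce z' z hz t ht]
      exact hzd t ht) ht
    have hz'y : z' = y := (hy z').1 fun t => by rw [← hz0]; exact hvoc t t.2
    intro t ht
    rw [← hz t ht, hz'y]

end SmoothingSemigroup

/-! ### Norms with values in `[0, ∞]` -/

section

variable {X : Type*} [NormedAddCommGroup X]

theorem enorm_le_ofReal_iff {x : X} {c : ℝ} (hc : 0 ≤ c) :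
    ‖x‖ₑ ≤ ENNReal.ofReal c ↔ ‖x‖ ≤ c := by
  rw [← ofReal_norm, ENNReal.ofReal_le_ofReal_iff hc]

theorem supNormOn_le_iff {a b c : ℝ} {u : ℝ → X} (hc : 0 ≤ c) :
    supNormOn a b u ≤ ENNReal.ofReal c ↔ ∀ t ∈ Icc a b, ‖u t‖ ≤ c := by
  simp only [supNormOn, iSup_le_iff, enorm_le_ofReal_iff hc]

theorem holderSeminormOn_le_iff {α a b c : ℝ} {u : ℝ → X} (hc : 0 ≤ c) :
    holderSeminormOn α a b u ≤ ENNReal.ofReal c ↔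
      ∀ s ∈ Icc a b, ∀ t ∈ Icc a b, ‖u t - u s‖ ≤ c * |t - s| ^ α := by
  have key : ∀ s t : ℝ, t ≠ s → (‖u t - u s‖ₑ / ENNReal.ofReal (|t - s| ^ α) ≤
      ENNReal.ofReal c ↔ ‖u t - u s‖ ≤ c * |t - s| ^ α) := by
    intro s t hts
    have hpos : 0 < |t - s| ^ α := Real.rpow_pos_of_pos (abs_pos.2 (sub_ne_zero.2 hts)) _
    rw [ENNReal.div_le_iff (ENNReal.ofReal_pos.2 hpos).ne' ENNReal.ofReal_ne_top,
      ← ENNReal.ofReal_mul hc, enorm_le_ofReal_iff (by positivity)]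
  simp only [holderSeminormOn, iSup_le_iff]
  refine ⟨fun h s hs t ht => ?_, fun h t ht s hs hts => (key s t hts).2 (h s hs t ht)⟩
  rcases eq_or_ne t s with rfl | hts
  · rw [sub_self, norm_zero]
    positivity
  · exact (key s t hts).1 (h t ht s hs hts)

theorem holderNormOn_lt_top {α a b : ℝ} {u : ℝ → X} (hα : 0 ≤ α) (h : MemHolderOn α a b u) :
    holderNormOn α a b u < ∞ := by
  refine ENNReal.add_lt_top.2 ⟨?_, h⟩
  have h1 := (holderSeminormOn_le_iff ENNReal.toReal_nonneg).1 (ENNReal.ofReal_toReal h.ne).ge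
  set c := (holderSeminormOn α a b u).toReal
  have hc : 0 ≤ c := ENNReal.toReal_nonneg
  have h2 : ∀ t ∈ Icc a b, ‖u t‖ ≤ ‖u a‖ + c * |b - a| ^ α := fun t ht => by
    have h3 := h1 a (left_mem_Icc.2 (ht.1.trans ht.2)) t ht
    have h4 : |t - a| ≤ |b - a| := by
      rw [abs_of_nonneg (by linarith [ht.1]), abs_of_nonneg (by linarith [ht.1, ht.2])]
      linarith [ht.2]
    have h5 : c * |t - a| ^ α ≤ c * |b - a| ^ α := by gcongr
    have h6 : ‖u t‖ ≤ ‖u a‖ + ‖u t - u a‖ := norm_le_norm_add_norm_sub' _ _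
    linarith
  exact ((supNormOn_le_iff (by positivity)).2 h2).trans_lt ENNReal.ofReal_lt_top

theorem holderNormOn_le {α a b c : ℝ} {u : ℝ → X} (hc : 0 ≤ c) (h₁ : ∀ t ∈ Icc a b, ‖u t‖ ≤ c)
    (h₂ : ∀ s ∈ Icc a b, ∀ t ∈ Icc a b, ‖u t - u s‖ ≤ c * |t - s| ^ α) :
    holderNormOn α a b u ≤ ENNReal.ofReal (2 * c) := by
  rw [two_mul, ENNReal.ofReal_add hc hc]
  exact add_le_add ((supNormOn_le_iff hc).2 h₁) ((holderSeminormOn_le_iff hc).2 h₂)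

theorem bounds_of_holderNormOn_le {α a b c : ℝ} {u : ℝ → X} (hc : 0 ≤ c)
    (h : holderNormOn α a b u ≤ ENNReal.ofReal c) : (∀ t ∈ Icc a b, ‖u t‖ ≤ c) ∧
      ∀ s ∈ Icc a b, ∀ t ∈ Icc a b, ‖u t - u s‖ ≤ c * |t - s| ^ α :=
  ⟨(supNormOn_le_iff hc).1 (le_self_add.trans h),
    (holderSeminormOn_le_iff hc).1 (le_add_self.trans h)⟩

end

/-! ### Classical solutions in the graph norm -/

section

variable {H : Type*} [NormedAddCommGroup H] [InnerProductSpace ℝ H] {A : H →ₗ.[ℝ] H}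

theorem opApply_eq_of_mem_graph {x v : H} (h : (x, v) ∈ A.graph) : opApply A x = v := by
  obtain ⟨y, rfl, hv⟩ := (LinearPMap.mem_graph_iff A).1 h
  rw [opApply, dif_pos y.2]
  exact hv

theorem mem_graph_opApply {x : H} (h : x ∈ A.domain) : (x, opApply A x) ∈ A.graph := by
  rw [opApply, dif_pos h]
  exact A.mem_graph ⟨x, h⟩

theorem norm_graphPoint (x : H) : ‖graphPoint A x‖ = ‖x‖ + ‖opApply A x‖ :=
  WithLp.prod_norm_eq_of_L1 _

theorem norm_graphPoint_sub (x y : H) :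
    ‖graphPoint A x - graphPoint A y‖ = ‖x - y‖ + ‖opApply A x - opApply A y‖ :=
  WithLp.prod_norm_eq_of_L1 _

theorem delayFunctional_shift (r : ℝ) (a : ℝ → ℝ) (B₀ B₁ : H →L[ℝ] H) (y : ℝ → H) (t : ℝ) :
    delayFunctional r a B₀ B₁ (fun θ => y (t + θ)) =
      B₁ (y (t - r)) + delayIntegral r a B₀ y t := by
  rw [delayFunctional, delayIntegral, sub_eq_add_neg]

theorem delayFunctional_eq (r : ℝ) (a : ℝ → ℝ) (B₀ B₁ : H →L[ℝ] H) (y : ℝ → H) :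
    delayFunctional r a B₀ B₁ y = B₁ (y (-r)) + delayIntegral r a B₀ y 0 := by
  simp only [delayFunctional, delayIntegral, zero_add]

theorem norm_opApply_le_of_interpSeminorm_le {S : ℝ → H →L[ℝ] H} {α N t : ℝ} {h : H}
    (hN : 0 ≤ N) (hh : interpSeminorm A S α h ≤ ENNReal.ofReal N) (ht : 0 < t) :
    ‖opApply A (S t h)‖ ≤ N * t ^ (α - 1) := by
  have h1 : ‖(t ^ (1 - α)) • opApply A (S t h)‖ ≤ N :=
    (enorm_le_ofReal_iff hN).1 ((le_iSup₂ (f := fun (t : ℝ) (_ : 0 < t) =>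
      ‖(t ^ (1 - α)) • opApply A (S t h)‖ₑ) t ht).trans hh)
  have hpos : 0 < t ^ (1 - α) := Real.rpow_pos_of_pos ht _
  rw [norm_smul, Real.norm_of_nonneg hpos.le] at h1
  rw [← neg_sub 1 α, Real.rpow_neg ht.le, ← div_eq_mul_inv, le_div_iff₀ hpos]
  linarith

/-- On `[0, T]` with `T > 0` one-sided derivatives are unique, and for `T = 0` the derivative
within the interval is `0` by convention. -/
theorem derivWithin_Icc_eqOn {u q : ℝ → H} {T : ℝ} (hT : 0 ≤ T)
    (h : ∀ t ∈ Icc 0 T, HasDerivWithinAt u (q t) (Icc 0 T) t) :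
    EqOn (derivWithin u (Icc 0 T)) q (Icc 0 T) ∨
      EqOn (derivWithin u (Icc 0 T)) 0 (Icc 0 T) := by
  rcases hT.eq_or_lt with rfl | hT
  · right
    intro t ht
    refine derivWithin_zero_of_not_accPt fun hacc => ?_
    obtain ⟨s, hs, hst⟩ := accPt_iff_nhds.1 hacc univ univ_mem
    exact hst ((le_antisymm hs.2.2 hs.2.1).trans (le_antisymm ht.2 ht.1).symm)
  · exact Or.inl fun t ht => (h t ht).derivWithin (uniqueDiffOn_Icc hT t ht)

end

theorem propositionA2 {H : Type*} [NormedAddCommGroup H] [InnerProductSpace ℝ H]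
    [CompleteSpace H]
    (S : ℝ → H →L[ℝ] H) (hS : IsAnalyticSemigroup S)
    (A : H →ₗ.[ℝ] H) (hA : IsGenerator A S)
    (r T α : ℝ) (hr : 0 < r) (hT : 0 ≤ T) (hα₀ : 0 < α) (hα₁ : α < 1)
    (a : ℝ → ℝ) (ha : IntegrableOn a (Icc (-r) 0)) (B₀ B₁ : H →L[ℝ] H) :
    ∃ C : ℝ, 0 < C ∧
      ∀ (f : ℝ → H) (φ₀ : H) (φ₁ : ℝ → H),
        MemHolderOn α 0 T f →
        φ₀ ∈ A.domain →
        MemHolderDomain A α (-r) 0 φ₁ →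
        φ₁ 0 = φ₀ →
        opApply A φ₀ + B₁ (φ₁ (-r)) + delayIntegral r a B₀ φ₁ 0 + f 0 ∈ interpSpace A S α →
        ∃ y : ℝ → H,
          IsClassicalSolution A r T a B₀ B₁ f φ₀ φ₁ y ∧
          (∀ z : ℝ → H, IsClassicalSolution A r T a B₀ B₁ f φ₀ φ₁ z →
            EqOn z y (Icc (-r) T)) ∧
          MemHolderDomain A α 0 T y ∧
          MemC1Holder α 0 T y ∧
          max (holderDomainNormOn A α 0 T y) (c1HolderNormOn α 0 T y) ≤
            ENNReal.ofReal C *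
              (holderNormOn α 0 T f + holderDomainNormOn A α (-r) 0 φ₁ + ‖φ₀‖ₑ +
                interpNorm A S α
                  (opApply A φ₀ + B₁ (φ₁ (-r)) + delayIntegral r a B₀ φ₁ 0 + f 0)) := by
  have hr' : -r ≤ 0 := by linarith
  have ha' : IntervalIntegrable a volume (-r) 0 := by
    rw [intervalIntegrable_iff_integrableOn_Icc_of_le hr']; exact ha
  obtain ⟨D, M, -, hP⟩ := hS.exists_smoothing hA (τ := T + 1)
  obtain ⟨K, hK, hsol⟩ := hP.exists_delay_solution hα₀ hα₁ hr.le hT (by linarith) ha' B₀ B₁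
  refine ⟨4 * K + 1, by positivity, ?_⟩
  rintro f _ φ hf hφ₀ hφ rfl hh
  set h₀ := opApply A (φ 0) + B₁ (φ (-r)) + delayIntegral r a B₀ φ 0 + f 0 with hh₀
  have hh₀' : opApply A (φ 0) + (delayFunctional r a B₀ B₁ φ + f 0) = h₀ := by
    rw [hh₀, delayFunctional_eq]; abel
  set Λ := holderNormOn α 0 T f + holderDomainNormOn A α (-r) 0 φ + ‖φ 0‖ₑ +
    interpNorm A S α h₀ with hΛ
  have hΛtop : Λ ≠ ∞ := by
    have h1 : holderNormOn α 0 T f < ∞ := holderNormOn_lt_top hα₀.le hf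
    have h2 : holderDomainNormOn A α (-r) 0 φ < ∞ := holderNormOn_lt_top hα₀.le hφ.2
    have h3 : interpNorm A S α h₀ < ∞ := ENNReal.add_lt_top.2 ⟨enorm_lt_top, hh.2⟩
    exact (ENNReal.add_lt_top.2 ⟨ENNReal.add_lt_top.2
      ⟨ENNReal.add_lt_top.2 ⟨h1, h2⟩, enorm_lt_top⟩, h3⟩).ne
  set N := Λ.toReal
  have hN : 0 ≤ N := ENNReal.toReal_nonneg
  have hΛN : Λ = ENNReal.ofReal N := (ENNReal.ofReal_toReal hΛtop).symm
  obtain ⟨hfN, hfα⟩ := bounds_of_holderNormOn_le (α := α) (u := f) hN (by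
    rw [← hΛN, hΛ, add_assoc, add_assoc]; exact le_self_add)
  obtain ⟨hgN, hgα⟩ := bounds_of_holderNormOn_le (α := α) (a := -r) (b := 0)
    (u := fun t => graphPoint A (φ t)) hN (by
      rw [← hΛN, hΛ]
      exact (le_add_self.trans le_self_add).trans le_self_add)
  simp only [norm_graphPoint, norm_graphPoint_sub] at hgN hgα
  have hiN : interpNorm A S α h₀ ≤ ENNReal.ofReal N := by
    rw [← hΛN, hΛ]; exact le_add_self
  have hh₀N : ‖h₀‖ ≤ N := (enorm_le_ofReal_iff hN).1 (le_self_add.trans hiN)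
  have hDh₀ : ∀ t, 0 < t → ‖D t h₀‖ ≤ N * t ^ (α - 1) := fun t ht => by
    have h1 := hP.mem_graph_deriv ht h₀
    simp only [max_eq_left ht.le] at h1
    rw [← opApply_eq_of_mem_graph h1]
    exact norm_opApply_le_of_interpSeminorm_le hN (le_add_self.trans hiN) ht
  have h0r : (0 : ℝ) ∈ Icc (-r) 0 := right_mem_Icc.2 hr'
  obtain ⟨y, p, q, hyφ, hyp, hq, hyd, hbd, hhol, huniq⟩ := hsol N f φ (opApply A (φ 0)) hfN hfα
    (fun t ht => by linarith [hgN t ht, norm_nonneg (opApply A (φ t))])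
    (fun s hs t ht => by
      linarith [hgα s hs t ht, norm_nonneg (opApply A (φ t) - opApply A (φ s))])
    (mem_graph_opApply hφ₀) (by linarith [hgN 0 h0r, norm_nonneg (φ 0)])
    (by rwa [hh₀']) (by rwa [hh₀'])
  have hKN : 0 ≤ K * N := by positivity
  have hp : ∀ t ∈ Icc 0 T, opApply A (y t) = p t := fun t ht =>
    opApply_eq_of_mem_graph (hyp t ht)
  have hdom : ∀ t ∈ Icc 0 T, y t ∈ A.domain := fun t ht =>
    LinearPMap.mem_domain_of_mem_graph (hyp t ht)
  have hGN : ∀ t ∈ Icc 0 T, ‖graphPoint A (y t)‖ ≤ 2 * (K * N) := fun t ht => by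
    rw [norm_graphPoint, hp t ht]
    linarith [hbd t ht]
  have hGα : ∀ s ∈ Icc 0 T, ∀ t ∈ Icc 0 T, ‖graphPoint A (y t) - graphPoint A (y s)‖ ≤
      2 * (K * N) * |t - s| ^ α := fun s hs t ht => by
    rw [norm_graphPoint_sub, hp t ht, hp s hs]
    linarith [hhol s hs t ht]
  obtain ⟨hdN, hdα⟩ : (∀ t ∈ Icc 0 T, ‖derivWithin y (Icc 0 T) t‖ ≤ K * N) ∧
      ∀ s ∈ Icc 0 T, ∀ t ∈ Icc 0 T, ‖derivWithin y (Icc 0 T) t - derivWithin y (Icc 0 T) s‖ ≤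
        K * N * |t - s| ^ α := by
    rcases derivWithin_Icc_eqOn hT hyd with h | h
    · refine ⟨fun t ht => ?_, fun s hs t ht => ?_⟩
      · rw [h ht]; exact (hbd t ht).2.2
      · rw [h ht, h hs]; exact (hhol s hs t ht).2.2
    · refine ⟨fun t ht => ?_, fun s hs t ht => ?_⟩
      · rw [h ht]; simpa using hKN
      · rw [h ht, h hs]
        simp only [Pi.zero_apply, sub_self, norm_zero]
        positivity
  have hHolder : MemHolderDomain A α 0 T y :=
    ⟨hdom, ((holderSeminormOn_le_iff (by positivity)).2 hGα).trans_lt ENNReal.ofReal_lt_top⟩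
  have hC1 : MemC1 0 T y := ⟨fun t ht => (hyd t ht).differentiableWithinAt,
    continuousOn_of_norm_sub_le_rpow hα₀ hdα⟩
  refine ⟨y, ⟨⟨hdom, continuousOn_of_norm_sub_le_rpow hα₀ hGα⟩, hC1, fun t ht => ?_, hyφ h0r,
    fun t ht => hyφ (Ico_subset_Icc_self ht)⟩, fun z hz => ?_, hHolder,
    ⟨hC1, ((holderSeminormOn_le_iff hKN).2 hdα).trans_lt ENNReal.ofReal_lt_top⟩, ?_⟩
  · refine (hyd t ht).congr_deriv ?_
    rw [hq t ht, hp t ht, delayFunctional_shift]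
    abel
  · refine huniq z (fun t => opApply A (z t)) (fun t ht => ?_)
      (fun t ht => mem_graph_opApply (hz.memCDomain.1 t ht)) fun t ht => ?_
    · rcases ht.2.eq_or_lt with rfl | h
      · exact hz.initial
      · exact hz.history t ⟨ht.1, h⟩
    · refine (hz.equation t ht).congr_deriv ?_
      rw [delayFunctional_shift]
      abel
  · rw [hΛN, ← ENNReal.ofReal_mul (by positivity)]
    refine max_le ?_ ?_
    · refine (holderNormOn_le (by positivity) hGN hGα).trans (ENNReal.ofReal_le_ofReal ?_)
      linarith
    · have h1 : supNormOn 0 T y ≤ ENNReal.ofReal (K * N) :=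
        (supNormOn_le_iff hKN).2 fun t ht => (hbd t ht).1
      refine (add_le_add h1 (holderNormOn_le hKN hdN hdα)).trans ?_
      rw [← ENNReal.ofReal_add hKN (by positivity)]
      refine ENNReal.ofReal_le_ofReal ?_
      linarith
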